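/- All logarithms are natural. There is an absolute constant $C>0$ such that the following holds. Let $n\ge 2$, $0<\epsilon<1$, $T\ge 0$, let $A_0\in\mathbb{R}^{n\times n}$ be symmetric positive semidefinite with $\lambda_{\max}(A_0)\le 1+\frac{\epsilon}{\log n}$, and let $v_1,\dots,v_T\in\mathbb{R}^n$ be a sequence fixed in advance (oblivious adversary) such that $A_t:=A_{t-1}-v_tv_t^{\top}\succeq 0$ for all $1\le t\le T$. Put $R=\lceil 10\log n\rceil$ and $K=\lceil \frac{4}{\epsilon}\log\frac n\epsilon\rceil$. The procedure $\mathrm{PowerMethod}(\epsilon,A)$ draws fresh independent vectors $g^{(1)},\dots,g^{(R)}\in\mathbb{R}^n$ with independent $N(0,1)$ coordinates and sets $w^{(r)}=A^Kg^{(r)}/\|A^Kg^{(r)}\|$ for $r\le R$ (and $w^{(r)}=0$ in case $A^Kg^{(r)}=0$). If $(w^{(r)})^{\top}Aw^{(r)}<1-\epsilon$ for all $r\le R$, it returns False; otherwise it returns $[r_0,W]$ with $W=[w^{(1)},\dots,w^{(R)}]$ and $r_0$ the smallest $r$ such that $(w^{(r)})^{\top}Aw^{(r)}\ge 1-5\epsilon$.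 The dynamic power method starts with $[r_0,W_0]\leftarrow\mathrm{PowerMethod}(\epsilon,A_0)$. At each time $t=1,\dots,T$, with $W_{t-1}=[w^{(1)},\dots,w^{(R)}]$: if $(w^{(r)})^{\top}A_tw^{(r)}<1-40\epsilon$ for all $r\le R$, it recomputes $[r_t,W_t]\leftarrow\mathrm{PowerMethod}(\epsilon,A_t)$; otherwise it sets $W_t=W_{t-1}$ and lets $r_t$ be the smallest $r$ such that $(w^{(r)})^{\top}A_tw^{(r)}\ge 1-40\epsilon$. As soon as a call of PowerMethod returns False, the algorithm answers False at all later times and makes no further calls. Then, with probability at least $1-\frac1n$, the number of times $t\in\{1,\dots,T\}$ at which the recomputation $\mathrm{PowerMethod}(\epsilon,A_t)$ is executed is at most $$C\cdot\frac{\log n\,\log^5\frac n\epsilon}{\epsilon^2}.$$ -/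

import Mathlib

open MeasureTheory ProbabilityTheory Matrix

noncomputable section

namespace DynPower

/-- The largest eigenvalue of a real (symmetric) matrix. -/
def lambdaMax {n : ℕ} (A : Matrix (Fin n) (Fin n) ℝ) : ℝ := sSup (spectrum ℝ A)

/-- The quadratic form `wᵀ A w`. -/
def quad {n : ℕ} (A : Matrix (Fin n) (Fin n) ℝ) (w : Fin n → ℝ) : ℝ := w ⬝ᵥ (A *ᵥ w)

/-- `x / ‖x‖` for the Euclidean norm `‖x‖ = √(x ⬝ᵥ x)`. -/
def normalize {n : ℕ} (x : Fin n → ℝ) : Fin n → ℝ := (√(x ⬝ᵥ x))⁻¹ • x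

/-- The number `R = 10 log n` of independent copies, rounded up. -/
def numCopies (n : ℕ) : ℕ := ⌈10 * Real.log n⌉₊

/-- The number `K = 4 log (n / ε) / ε` of power iterations, rounded up. -/
def numIters (n : ℕ) (ε : ℝ) : ℕ := ⌈4 * Real.log (n / ε) / ε⌉₊

/-- One copy of the power iteration: start at `g`, replace `x` by `A x` for `K` rounds, normalize. -/
def powerIterate {n : ℕ} (ε : ℝ) (A : Matrix (Fin n) (Fin n) ℝ) (g : Fin n → ℝ) : Fin n → ℝ :=
  normalize ((fun x => A *ᵥ x)^[numIters n ε] g)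

/-- A list `W = [w⁽¹⁾, …, w⁽ᴿ⁾]` of vectors in `ℝⁿ`. -/
abbrev Vecs (n : ℕ) : Type := Fin (numCopies n) → Fin n → ℝ

/-- The smallest index `r` (counted from `0`) with `w⁽ʳ⁾ᵀ A w⁽ʳ⁾ ≥ c`. -/
def firstIndex {n : ℕ} (A : Matrix (Fin n) (Fin n) ℝ) (W : Vecs n) (c : ℝ) : ℕ :=
  sInf {r : ℕ | ∃ h : r < numCopies n, c ≤ quad A (W ⟨r, h⟩)}

open Classical in
/-- `PowerMethod(ε, A)` with initial vectors `G`; the answer `none` stands for `False`. -/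
def powerMethod {n : ℕ} (ε : ℝ) (A : Matrix (Fin n) (Fin n) ℝ) (G : Vecs n) :
    Option (ℕ × Vecs n) :=
  let W : Vecs n := fun r => powerIterate ε A (G r)
  if ∀ r, quad A (W r) < 1 - ε then none
  else some (firstIndex A W (1 - 5 * ε), W)

/-- What the dynamic algorithm holds after an update: its current answer `[r_t, W_t]` (`none` for
`False`), and how many times an update has recomputed the vectors by calling `powerMethod`. -/
structure State (n : ℕ) where
  answer : Option (ℕ × Vecs n)
  recomputations : ℕ

open Classical in
/-- `Update(v_t)`, where `A = A_{t-1} - v_t v_tᵀ` is the new matrix and `G` holds the fresh initial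
vectors for the call of the power method in this update, if there is one. Once the answer is
`False`, it stays `False`. -/
def update {n : ℕ} (ε : ℝ) (A : Matrix (Fin n) (Fin n) ℝ) (G : Vecs n) (s : State n) : State n :=
  match s.answer with
  | none => s
  | some (_, W) =>
      if ∀ r, quad A (W r) < 1 - 40 * ε then
        { answer := powerMethod ε A G
          recomputations := s.recomputations + 1 }
      else
        { answer := some (firstIndex A W (1 - 40 * ε), W)
          recomputations := s.recomputations }

/-- `A_t = A_{t-1} - v_t v_tᵀ`; the updates are `v 1, v 2, …` and `v 0` is not used. -/
def matrixAt {n : ℕ} (A₀ : Matrix (Fin n) (Fin n) ℝ) (v : ℕ → Fin n → ℝ) :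
    ℕ → Matrix (Fin n) (Fin n) ℝ
  | 0 => A₀
  | t + 1 => matrixAt A₀ v t - vecMulVec (v (t + 1)) (v (t + 1))

/-- The state after initialization by `PowerMethod(ε, A₀)` (which is not counted) and the updates
`v 1, …, v t`; `G t` holds the initial vectors that are fresh for time `t`. -/
def run {n : ℕ} (ε : ℝ) (A₀ : Matrix (Fin n) (Fin n) ℝ) (v : ℕ → Fin n → ℝ) (G : ℕ → Vecs n) :
    ℕ → State n
  | 0 => { answer := powerMethod ε A₀ (G 0), recomputations := 0 }
  | t + 1 => update ε (matrixAt A₀ v (t + 1)) (G (t + 1)) (run ε A₀ v G t)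

end DynPower

end

/-!
The proof measures progress by the potential `tr (A ^ (2 K + 1))`, where `K` is the number of power
iterations, and shows that a call of the power method is followed by a drop of the potential by a
factor `q = 1 - ε / 8` before its vectors are rejected, unless the call fails, which has probability
at most `1 / (2 n)`.

*Linear algebra.* For `0 ≤ B ≤ A`, `tr (A ^ m (A - B)) ≤ tr (A ^ (m + 1)) - tr (B ^ (m + 1))`
(`trace_pow_mul_sub_le`). So as long as the potential has not dropped by the factor `q` between
`A` and `B`, the trace of `A ^ (2 K) (A - B)` is at most `(ε / 4) tr (A ^ (2 K))`.

*One copy.* For a standard Gaussian vector `x`, the expected value of `xᵀ A ^ K (A - B) A ^ K x` is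
this trace, whereas the normalization `xᵀ A ^ (2 K) x` is rarely much smaller than its expected
value `tr (A ^ (2 K))` (`measureReal_quad_pow_lt_le`). Eigendirections of eigenvalue below `1 - 3 ε`
are negligible after `K` iterations. Hence the normalized `A ^ K x` still has Rayleigh quotient at
least `1 - 40 ε` at `B` with probability at least `1 / 5`
(`measureReal_quad_powerIterate_lt_le`), and all copies fail with probability at most `1 / (2 n)`
(`measureReal_failureSet_le`). Because the updates are fixed in advance, the last matrix `B` before
the drop of the potential does not depend on the Gaussian vectors, and it suffices to look at this
single `B`.

*Counting.* The potential starts at no more than `n (1 + ε / log n) ^ (2 K + 1)`, and is at least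
`(1 - ε) ^ (2 K + 1)` whenever the power method returns an answer. Therefore the number of
recomputations exceeds the number of failed calls by at most `1 + 216 log (n / ε) / ε`
(`recomputations_le_failures_add`).

*Probability.* Whether time `s + 1` recomputes is decided by the initial vectors of earlier times,
so among the initial call and the first `M` recomputations the expected number of failures is at
most `(M + 1) / (2 n)` (`integral_earlyFailures_le`). For `M` about `2 (216 log (n / ε) / ε)`, more
than `M` recomputations would require about `M / 2` failures among these calls, which by Markov's
inequality has probability at most `1 / n`. The resulting bound `O (log (n / ε) / ε)` is stronger
than the one asked for. For `ε ≥ 1 / 40` the threshold `1 - 40 ε` is not positive, and positive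
semidefinite matrices never trigger a recomputation.
-/

namespace DynPower

/-! ### Traces of powers of positive semidefinite matrices -/

section Trace

variable {n : ℕ} {A B : Matrix (Fin n) (Fin n) ℝ}

/-- A real matrix whose columns form an orthonormal eigenbasis of the symmetric matrix `A`. -/
noncomputable def eigenMatrix (hA : A.IsHermitian) : Matrix (Fin n) (Fin n) ℝ :=
  (hA.eigenvectorUnitary : Matrix (Fin n) (Fin n) ℝ)

lemma eigenMatrix_transpose_mul (hA : A.IsHermitian) : (eigenMatrix hA)ᵀ * eigenMatrix hA = 1 := by
  have := Unitary.coe_star_mul_self hA.eigenvectorUnitary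
  rwa [star_eq_conjTranspose, conjTranspose_eq_transpose_of_trivial] at this

lemma eigenMatrix_mul_transpose (hA : A.IsHermitian) : eigenMatrix hA * (eigenMatrix hA)ᵀ = 1 :=
  mul_eq_one_comm.mp (eigenMatrix_transpose_mul hA)

lemma pow_eq_eigenMatrix (hA : A.IsHermitian) (m : ℕ) :
    A ^ m = eigenMatrix hA * diagonal (fun k => hA.eigenvalues k ^ m) * (eigenMatrix hA)ᵀ := by
  have h1 : A = eigenMatrix hA * diagonal hA.eigenvalues * (eigenMatrix hA)ᵀ := by
    have := hA.spectral_theorem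
    rw [Unitary.conjStarAlgAut_apply] at this
    simpa [eigenMatrix, star_eq_conjTranspose, Function.comp_def] using this
  induction m with
  | zero => simp [eigenMatrix_mul_transpose hA]
  | succ m ih =>
    calc A ^ (m + 1) = eigenMatrix hA * diagonal (fun k => hA.eigenvalues k ^ m) *
          (eigenMatrix hA)ᵀ * (eigenMatrix hA * diagonal hA.eigenvalues * (eigenMatrix hA)ᵀ) := by
            rw [pow_succ, ih, ← h1]
      _ = eigenMatrix hA * diagonal (fun k => hA.eigenvalues k ^ m) *
          ((eigenMatrix hA)ᵀ * eigenMatrix hA) * diagonal hA.eigenvalues * (eigenMatrix hA)ᵀ := by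
            simp only [Matrix.mul_assoc]
      _ = _ := by
        rw [eigenMatrix_transpose_mul, Matrix.mul_one, Matrix.mul_assoc (eigenMatrix hA),
          diagonal_mul_diagonal]
        simp only [pow_succ]

lemma trace_pow_eq (hA : A.IsHermitian) (m : ℕ) :
    (A ^ m).trace = ∑ k, hA.eigenvalues k ^ m := by
  rw [pow_eq_eigenMatrix hA, trace_mul_comm, ← Matrix.mul_assoc, eigenMatrix_transpose_mul,
    Matrix.one_mul, trace_diagonal]

/-- The coordinates of a vector in the eigenbasis of `A`. -/
noncomputable def eigenCoord (hA : A.IsHermitian) (x : Fin n → ℝ) : Fin n → ℝ :=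
  (eigenMatrix hA)ᵀ *ᵥ x

lemma quad_pow_eq (hA : A.IsHermitian) (m : ℕ) (x : Fin n → ℝ) :
    quad (A ^ m) x = ∑ k, hA.eigenvalues k ^ m * eigenCoord hA x k ^ 2 := by
  rw [quad, pow_eq_eigenMatrix hA, ← mulVec_mulVec, ← mulVec_mulVec, dotProduct_mulVec,
    ← mulVec_transpose]
  simp only [dotProduct, mulVec_diagonal, eigenCoord]
  exact Finset.sum_congr rfl fun k _ => by ring

lemma dotProduct_self_eq (hA : A.IsHermitian) (x : Fin n → ℝ) :
    x ⬝ᵥ x = ∑ k, eigenCoord hA x k ^ 2 := by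
  simpa [quad] using quad_pow_eq hA 0 x

lemma trace_pow_mul_pow_eq (hA : A.IsHermitian) (hB : B.IsHermitian) (a b : ℕ) :
    (A ^ a * B ^ b).trace = ∑ i, ∑ k, ((eigenMatrix hA)ᵀ * eigenMatrix hB) i k ^ 2 *
      (hA.eigenvalues i ^ a * hB.eigenvalues k ^ b) := by
  set W := (eigenMatrix hA)ᵀ * eigenMatrix hB with hW
  have h : (A ^ a * B ^ b).trace = (diagonal (fun k => hA.eigenvalues k ^ a) * W *
      diagonal (fun k => hB.eigenvalues k ^ b) * Wᵀ).trace := by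
    have h1 : A ^ a * B ^ b = eigenMatrix hA * (diagonal (fun k => hA.eigenvalues k ^ a) * W *
        diagonal (fun k => hB.eigenvalues k ^ b) * (eigenMatrix hB)ᵀ) := by
      rw [pow_eq_eigenMatrix hA, pow_eq_eigenMatrix hB, hW]
      simp only [Matrix.mul_assoc]
    rw [h1, trace_mul_comm, hW, transpose_mul, transpose_transpose]
    simp only [Matrix.mul_assoc]
  rw [h, trace]
  refine Finset.sum_congr rfl fun i _ => ?_
  rw [diag_apply, Matrix.mul_apply]
  refine Finset.sum_congr rfl fun k _ => ?_
  rw [mul_diagonal, diagonal_mul, transpose_apply]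
  ring

lemma trace_pow_mul_nonneg (hA : A.PosSemidef) {V : Matrix (Fin n) (Fin n) ℝ} (hV : V.PosSemidef)
    (m : ℕ) : 0 ≤ (A ^ m * V).trace := by
  rw [pow_eq_eigenMatrix hA.isHermitian, trace_mul_comm, ← Matrix.mul_assoc, ← Matrix.mul_assoc,
    trace_mul_comm]
  have h := (hV.mul_mul_conjTranspose_same (eigenMatrix hA.isHermitian)ᵀ)
  rw [conjTranspose_eq_transpose_of_trivial, transpose_transpose] at h
  have h2 : ((eigenMatrix hA.isHermitian)ᵀ * (V * eigenMatrix hA.isHermitian *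
      diagonal fun k => hA.isHermitian.eigenvalues k ^ m)).trace =
      ∑ k, ((eigenMatrix hA.isHermitian)ᵀ * V * eigenMatrix hA.isHermitian) k k *
        hA.isHermitian.eigenvalues k ^ m := by
    rw [← Matrix.mul_assoc, ← Matrix.mul_assoc, trace]
    simp [mul_diagonal]
  rw [h2]
  exact Finset.sum_nonneg fun k _ =>
    mul_nonneg h.diag_nonneg (pow_nonneg (hA.eigenvalues_nonneg k) m)

/-- For `0 ≤ B ≤ A` the trace of `A ^ (m + 1)` drops at least by the first-order term
`tr (A ^ m (A - B))` with the *larger* matrix `A`. In eigenbases of `A` and `B` this is Bernoulli's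
inequality `α ^ m ≥ β ^ m + m β ^ (m - 1) (α - β)`, multiplied by `β` and averaged. -/
lemma trace_pow_mul_sub_le (hA : A.PosSemidef) (hB : B.PosSemidef) (hAB : (A - B).PosSemidef)
    (m : ℕ) : (A ^ m * (A - B)).trace ≤ (A ^ (m + 1)).trace - (B ^ (m + 1)).trace := by
  have hb := hB.isHermitian
  have ha := hA.isHermitian
  rw [Matrix.mul_sub, trace_sub, ← pow_succ]
  suffices h : (B ^ (m + 1)).trace ≤ (B * A ^ m).trace by
    rw [trace_mul_comm] at h; linarith
  have e1 := trace_pow_mul_pow_eq hb ha (m + 1) 0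
  have e2 := trace_pow_mul_pow_eq hb ha 1 m
  have e3 := trace_pow_mul_pow_eq hb ha m 1
  have h3 : 0 ≤ (B ^ m * A ^ 1).trace - (B ^ (m + 1) * A ^ 0).trace := by
    have := trace_pow_mul_nonneg hB hAB m
    rw [Matrix.mul_sub, trace_sub, ← pow_succ] at this
    simpa using this
  have key : (m : ℝ) * ((B ^ m * A ^ 1).trace - (B ^ (m + 1) * A ^ 0).trace) ≤
      (B ^ 1 * A ^ m).trace - (B ^ (m + 1) * A ^ 0).trace := by
    rw [e1, e2, e3]
    simp only [← Finset.sum_sub_distrib, Finset.mul_sum]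
    refine Finset.sum_le_sum fun i _ => Finset.sum_le_sum fun k _ => ?_
    set α := ha.eigenvalues k
    set β := hb.eigenvalues i
    have hα : 0 ≤ α := hA.eigenvalues_nonneg k
    have hβ : 0 ≤ β := hB.eigenvalues_nonneg i
    have hbern : (m : ℝ) * (β ^ m * α - β ^ (m + 1)) ≤ β * α ^ m - β ^ (m + 1) := by
      rcases eq_or_lt_of_le hβ with h0 | h0
      · rcases m with _ | m <;> simp [← h0]
      · have h1 := one_add_mul_sub_le_pow (a := α / β) (n := m)
          (le_trans (by norm_num) (div_nonneg hα hβ))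
        have h2 := mul_le_mul_of_nonneg_left h1 (pow_nonneg hβ (m + 1))
        have h4 : β ^ (m + 1) * (α / β) ^ m = β * α ^ m := by
          rw [div_pow]; field_simp; ring
        have h5 : β ^ (m + 1) * (1 + m * (α / β - 1)) =
            β ^ (m + 1) + m * (β ^ m * α - β ^ (m + 1)) := by
          field_simp
          ring
        linarith
    have := mul_le_mul_of_nonneg_left hbern
      (sq_nonneg (((eigenMatrix hb)ᵀ * eigenMatrix ha) i k))
    simp only [pow_one, pow_zero, mul_one]
    nlinarith
  have h4 := mul_nonneg (Nat.cast_nonneg (α := ℝ) m) h3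
  simp only [pow_one, pow_zero, Matrix.mul_one] at key h4
  linarith

lemma trace_pow_succ_le (hA : A.PosSemidef) (hB : B.PosSemidef) (hAB : (A - B).PosSemidef)
    (m : ℕ) : (B ^ (m + 1)).trace ≤ (A ^ (m + 1)).trace := by
  linarith [trace_pow_mul_sub_le hA hB hAB m, trace_pow_mul_nonneg hA hAB m]

lemma quad_nonneg (hA : A.PosSemidef) (x : Fin n → ℝ) : 0 ≤ quad A x := by
  simpa [quad] using hA.dotProduct_mulVec_nonneg x

lemma quad_sub (A B : Matrix (Fin n) (Fin n) ℝ) (x : Fin n → ℝ) :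
    quad (A - B) x = quad A x - quad B x := by
  simp [quad, sub_mulVec, dotProduct_sub]

lemma quad_smul (A : Matrix (Fin n) (Fin n) ℝ) (c : ℝ) (x : Fin n → ℝ) :
    quad A (c • x) = c ^ 2 * quad A x := by
  simp [quad, mulVec_smul]; ring

lemma quad_normalize (A : Matrix (Fin n) (Fin n) ℝ) (x : Fin n → ℝ) :
    quad A (normalize x) = quad A x / (x ⬝ᵥ x) := by
  have h : 0 ≤ x ⬝ᵥ x := dotProduct_self_star_nonneg x
  rw [normalize, quad_smul, inv_pow, Real.sq_sqrt h]
  ring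

lemma iterate_mulVec (A : Matrix (Fin n) (Fin n) ℝ) (m : ℕ) (x : Fin n → ℝ) :
    (fun y => A *ᵥ y)^[m] x = A ^ m *ᵥ x := by
  induction m generalizing x with
  | zero => simp
  | succ m ih => rw [Function.iterate_succ_apply, ih, mulVec_mulVec, pow_succ]

lemma quad_mulVec_pow (hA : A.IsHermitian) (M : Matrix (Fin n) (Fin n) ℝ) (m : ℕ)
    (x : Fin n → ℝ) : quad M (A ^ m *ᵥ x) = quad (A ^ m * M * A ^ m) x := by
  have h : (A ^ m)ᵀ = A ^ m := by
    rw [transpose_pow, ← conjTranspose_eq_transpose_of_trivial, hA.eq]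
  rw [quad, quad, ← mulVec_mulVec, ← mulVec_mulVec, dotProduct_mulVec _ (A ^ m), ← mulVec_transpose,
    h]

/-- A symmetric matrix with a Rayleigh quotient `≥ c > 0` at a vector of length at most `1` has an
eigenvalue `≥ c`. -/
lemma exists_le_eigenvalues (hA : A.IsHermitian) {c : ℝ} (hc : 0 < c) {x : Fin n → ℝ}
    (hx : x ⬝ᵥ x ≤ 1) (h : c ≤ quad A x) : ∃ k, c ≤ hA.eigenvalues k := by
  by_contra! hlt
  have h1 : quad A x = ∑ k, hA.eigenvalues k * eigenCoord hA x k ^ 2 := by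
    simpa using quad_pow_eq hA 1 x
  have h2 := dotProduct_self_eq hA x
  have h3 : c * (x ⬝ᵥ x) ≤ c := by nlinarith
  have h4 : ∑ k, hA.eigenvalues k * eigenCoord hA x k ^ 2 ≤ ∑ k, c * eigenCoord hA x k ^ 2 :=
    Finset.sum_le_sum fun k _ => mul_le_mul_of_nonneg_right (hlt k).le (sq_nonneg _)
  rw [← Finset.mul_sum, ← h2, ← h1] at h4
  have h5 : ∑ k, (c - hA.eigenvalues k) * eigenCoord hA x k ^ 2 = 0 := by
    simp only [sub_mul, Finset.sum_sub_distrib, ← Finset.mul_sum]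
    rw [← h1, ← h2]; linarith
  rw [Finset.sum_eq_zero_iff_of_nonneg
    fun k _ => mul_nonneg (sub_nonneg.2 (hlt k).le) (sq_nonneg _)] at h5
  have h6 : x ⬝ᵥ x = 0 := by
    rw [h2]
    exact Finset.sum_eq_zero fun k hk =>
      (mul_eq_zero.1 (h5 k hk)).resolve_left (sub_ne_zero.2 (hlt k).ne')
  nlinarith

lemma normalize_dotProduct_self_le (x : Fin n → ℝ) : normalize x ⬝ᵥ normalize x ≤ 1 := by
  have := quad_normalize 1 x
  simp only [quad, one_mulVec] at this
  rw [this]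
  exact div_self_le_one _

lemma eigenvalues_le_lambdaMax (hA : A.IsHermitian) (k : Fin n) :
    hA.eigenvalues k ≤ lambdaMax A :=
  le_csSup finite_real_spectrum.bddAbove (hA.eigenvalues_mem_spectrum_real k)

/-- If `0 ≤ B ≤ A`, no eigenvalue of `B` exceeds the largest eigenvalue of `A`. -/
lemma eigenvalues_le_lambdaMax_of_le (hA : A.PosSemidef) (hB : B.PosSemidef)
    (hAB : (A - B).PosSemidef) (k : Fin n) : hB.isHermitian.eigenvalues k ≤ lambdaMax A := by
  have hb := hB.isHermitian
  by_contra! hlt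
  set u : Fin n → ℝ := fun i => eigenMatrix hb i k with hu
  have hcoord : eigenCoord hb u = Pi.single k 1 := by
    funext l
    have h := congrFun (congrFun (eigenMatrix_transpose_mul hb) l) k
    rw [Matrix.mul_apply] at h
    rw [Pi.single_apply, ← one_apply]
    exact h
  have huu : u ⬝ᵥ u = 1 := by
    rw [dotProduct_self_eq hb, hcoord]
    simp [Pi.single_apply]
  have hqu : quad B u = hb.eigenvalues k := by
    have h := quad_pow_eq hb 1 u
    rw [hcoord] at h
    simpa [Pi.single_apply] using h
  have hq := quad_nonneg hAB u
  rw [quad_sub, hqu] at hq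
  have h0 : 0 ≤ lambdaMax A :=
    (hA.eigenvalues_nonneg k).trans (eigenvalues_le_lambdaMax hA.isHermitian k)
  obtain ⟨l, hl⟩ := exists_le_eigenvalues hA.isHermitian (h0.trans_lt hlt) huu.le (sub_nonneg.1 hq)
  exact absurd (hl.trans (eigenvalues_le_lambdaMax hA.isHermitian l)) (not_le.2 hlt)

end Trace

/-! ### Gaussian quadratic forms -/

section Gaussian

variable {n : ℕ} {Ω : Type*} [MeasurableSpace Ω] {μ : Measure Ω}
  {x : Fin n → Ω → ℝ}

lemma integrable_mul_gaussian (hx : ∀ i, HasLaw (x i) (gaussianReal 0 1) μ) (i j : Fin n) :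
    Integrable (fun ω => x i ω * x j ω) μ :=
  (hx i).hasGaussianLaw.memLp_two.integrable_mul (hx j).hasGaussianLaw.memLp_two

lemma integral_mul_gaussian (hx : ∀ i, HasLaw (x i) (gaussianReal 0 1) μ) (hi : iIndepFun x μ)
    (i j : Fin n) : ∫ ω, x i ω * x j ω ∂μ = if i = j then 1 else 0 := by
  have h0 : ∀ i, ∫ ω, x i ω ∂μ = 0 := fun i => by
    rw [(hx i).integral_eq, integral_id_gaussianReal]
  split_ifs with h
  · subst h
    have h1 := (hx i).variance_eq
    rw [variance_id_gaussianReal, variance_of_integral_eq_zero (hx i).aemeasurable (h0 i)] at h1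
    simpa [sq] using h1
  · have h1 := (hi.indepFun h).integral_fun_mul_eq_mul_integral
      (hx i).aemeasurable.aestronglyMeasurable (hx j).aemeasurable.aestronglyMeasurable
    rw [h1, h0, zero_mul]

lemma quad_eq_sum (N : Matrix (Fin n) (Fin n) ℝ) (y : Fin n → ℝ) :
    quad N y = ∑ i, ∑ j, N i j * (y i * y j) := by
  simp only [quad, dotProduct, mulVec, Finset.mul_sum]
  exact Finset.sum_congr rfl fun i _ => Finset.sum_congr rfl fun j _ => by ring

lemma integrable_quad_gaussian (hx : ∀ i, HasLaw (x i) (gaussianReal 0 1) μ)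
    (N : Matrix (Fin n) (Fin n) ℝ) : Integrable (fun ω => quad N (fun i => x i ω)) μ := by
  simp only [quad_eq_sum]
  exact integrable_finsetSum _ fun i _ => integrable_finsetSum _ fun j _ =>
    (integrable_mul_gaussian hx i j).const_mul _

lemma integral_quad_gaussian (hx : ∀ i, HasLaw (x i) (gaussianReal 0 1) μ) (hi : iIndepFun x μ)
    (N : Matrix (Fin n) (Fin n) ℝ) : ∫ ω, quad N (fun i => x i ω) ∂μ = N.trace := by
  simp only [quad_eq_sum]
  have hint : ∀ i j, Integrable (fun ω => N i j * (x i ω * x j ω)) μ := fun i j =>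
    (integrable_mul_gaussian hx i j).const_mul _
  rw [integral_finsetSum _ fun i _ => integrable_finsetSum _ fun j _ => hint i j]
  refine Finset.sum_congr rfl fun i _ => ?_
  rw [integral_finsetSum _ fun j _ => hint i j]
  simp [integral_const_mul, integral_mul_gaussian hx hi]

/-- Rotation invariance of the standard Gaussian vector, one coordinate at a time. -/
lemma hasLaw_dotProduct_gaussian (hx : ∀ i, HasLaw (x i) (gaussianReal 0 1) μ)
    (hi : iIndepFun x μ) {u : Fin n → ℝ} (hu : u ⬝ᵥ u = 1) :
    HasLaw (fun ω => u ⬝ᵥ fun i => x i ω) (gaussianReal 0 1) μ := by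
  have hg : HasGaussianLaw (fun ω => u ⬝ᵥ fun i => x i ω) μ := by
    have h1 : iIndepFun (fun i ω => u i * x i ω) μ :=
      hi.comp (fun i y => u i * y) fun i => measurable_const_mul _
    exact iIndepFun.hasGaussianLaw_fun_sum
      (fun i => (hx i).hasGaussianLaw.fun_smul (u i)) h1
  have h0 : ∫ ω, (u ⬝ᵥ fun i => x i ω) ∂μ = 0 := by
    simp only [dotProduct]
    rw [integral_finsetSum _ fun i _ => (hx i).hasGaussianLaw.integrable.const_mul _]
    refine Finset.sum_eq_zero fun i _ => ?_
    rw [integral_const_mul, (hx i).integral_eq, integral_id_gaussianReal, mul_zero]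
  have h2 : ∫ ω, (u ⬝ᵥ fun i => x i ω) ^ 2 ∂μ = 1 := by
    have h3 : ∀ y : Fin n → ℝ, (u ⬝ᵥ y) ^ 2 = quad (vecMulVec u u) y := fun y => by
      rw [quad, vecMulVec_mulVec, op_smul_eq_smul, dotProduct_smul, dotProduct_comm y u, sq,
        smul_eq_mul]
    simp only [h3]
    rw [integral_quad_gaussian hx hi, trace_vecMulVec, hu]
  refine ⟨hg.aemeasurable, ?_⟩
  rw [hg.map_eq_gaussianReal, h0, variance_of_integral_eq_zero hg.aemeasurable h0, h2]
  simp

lemma integral_exp_neg_mul_sq_gaussianReal :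
    ∫ z, Real.exp (-(12 * z ^ 2)) ∂(gaussianReal 0 1) = 1 / 5 := by
  rw [integral_gaussianReal_eq_integral_smul one_ne_zero]
  have h : ∀ z : ℝ, gaussianPDFReal 0 1 z • Real.exp (-(12 * z ^ 2)) =
      (√(2 * Real.pi))⁻¹ * Real.exp (-(25 / 2) * z ^ 2) := fun z => by
    rw [gaussianPDFReal, smul_eq_mul, mul_assoc, ← Real.exp_add]
    simp only [NNReal.coe_one, mul_one, sub_zero]
    congr 2
    ring
  simp only [h]
  rw [integral_const_mul, integral_gaussian,
    show Real.pi / (25 / 2) = (2 * Real.pi) / 5 ^ 2 by ring,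
    Real.sqrt_div (by positivity), Real.sqrt_sq (by norm_num)]
  have : √(2 * Real.pi) ≠ 0 := by positivity
  field_simp

lemma hasLaw_eigenCoord (hx : ∀ i, HasLaw (x i) (gaussianReal 0 1) μ) (hi : iIndepFun x μ)
    {A : Matrix (Fin n) (Fin n) ℝ} (hA : A.IsHermitian) (k : Fin n) :
    HasLaw (fun ω => eigenCoord hA (fun i => x i ω) k) (gaussianReal 0 1) μ := by
  refine hasLaw_dotProduct_gaussian hx hi (u := (eigenMatrix hA)ᵀ k) ?_
  have := congrFun (congrFun (eigenMatrix_transpose_mul hA) k) k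
  rwa [Matrix.mul_apply, one_apply_eq] at this

/-- A lower-tail bound for a Gaussian quadratic form: a convex combination of squares of standard
normal variables is rarely below `1 / 50`, whatever the weights and the dependence, since by Jensen
its Laplace transform at `12` is at most that of a single square, which is `25 ^ (-1 / 2)`. -/
lemma measureReal_quad_pow_lt_le (hx : ∀ i, HasLaw (x i) (gaussianReal 0 1) μ)
    (hi : iIndepFun x μ) {A : Matrix (Fin n) (Fin n) ℝ} (hA : A.PosSemidef) (m : ℕ)
    (hpos : 0 < (A ^ m).trace) :
    μ.real {ω | quad (A ^ m) (fun i => x i ω) < (A ^ m).trace / 50} ≤ 3 / 10 := by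
  have := hi.isProbabilityMeasure
  have ha := hA.isHermitian
  set τ := (A ^ m).trace with hτ
  set w : Fin n → ℝ := fun k => ha.eigenvalues k ^ m / τ with hw
  have hw0 : ∀ k, 0 ≤ w k := fun k => div_nonneg (pow_nonneg (hA.eigenvalues_nonneg k) m) hpos.le
  have hw1 : ∑ k, w k = 1 := by
    rw [hw, ← Finset.sum_div, ← trace_pow_eq ha, div_self hpos.ne']
  set z : Fin n → Ω → ℝ := fun k ω => eigenCoord ha (fun i => x i ω) k
  have hz : ∀ k, HasLaw (z k) (gaussianReal 0 1) μ := hasLaw_eigenCoord hx hi ha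
  have hzm : ∀ k, AEMeasurable (fun ω => Real.exp (-(12 * z k ω ^ 2))) μ := fun k =>
    (show Measurable fun y : ℝ => Real.exp (-(12 * y ^ 2)) by fun_prop).comp_aemeasurable
      (hz k).aemeasurable
  have hint : ∀ k, Integrable (fun ω => Real.exp (-(12 * z k ω ^ 2))) μ := fun k => by
    refine Integrable.of_bound (hzm k).aestronglyMeasurable 1 (ae_of_all _ fun ω => ?_)
    rw [Real.norm_eq_abs, abs_of_pos (Real.exp_pos _), Real.exp_le_one_iff]
    nlinarith [sq_nonneg (z k ω)]
  have hz5 : ∀ k, ∫ ω, Real.exp (-(12 * z k ω ^ 2)) ∂μ = 1 / 5 := fun k => by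
    rw [← integral_exp_neg_mul_sq_gaussianReal, ← (hz k).integral_comp]
    · rfl
    · fun_prop
  set F : Ω → ℝ := fun ω => ∑ k, w k * Real.exp (-(12 * z k ω ^ 2)) with hF
  have hFint : Integrable F μ := integrable_finsetSum _ fun k _ => (hint k).const_mul _
  have hFI : ∫ ω, F ω ∂μ = 1 / 5 := by
    rw [hF, integral_finsetSum _ fun k _ => (hint k).const_mul _]
    simp only [integral_const_mul, hz5]
    rw [← Finset.sum_mul, hw1, one_mul]
  have hsub : {ω | quad (A ^ m) (fun i => x i ω) < τ / 50} ⊆ {ω | Real.exp (-(6 / 25)) ≤ F ω} := by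
    intro ω hω
    have hj := convexOn_exp.map_sum_le (t := Finset.univ) (w := w)
      (p := fun k => -(12 * z k ω ^ 2)) (fun k _ => hw0 k) hw1 fun k _ => Set.mem_univ _
    simp only [smul_eq_mul] at hj
    refine le_trans (Real.exp_le_exp.2 ?_) hj
    have hq : ∑ k, w k * -(12 * z k ω ^ 2) = -12 * (quad (A ^ m) (fun i => x i ω) / τ) := by
      rw [quad_pow_eq ha, Finset.sum_div, Finset.mul_sum]
      exact Finset.sum_congr rfl fun k _ => by simp only [hw, z]; ring
    rw [hq]
    have : quad (A ^ m) (fun i => x i ω) / τ < 1 / 50 := by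
      rw [div_lt_iff₀ hpos]
      have : quad (A ^ m) (fun i => x i ω) < τ / 50 := hω
      linarith
    linarith
  have hmk := mul_meas_ge_le_integral_of_nonneg (μ := μ) (f := F)
    (ae_of_all _ fun ω => Finset.sum_nonneg fun k _ => mul_nonneg (hw0 k) (Real.exp_pos _).le)
    hFint (Real.exp (-(6 / 25)))
  rw [hFI] at hmk
  have hle := measureReal_mono (μ := μ) hsub
  have he : (19 / 25 : ℝ) ≤ Real.exp (-(6 / 25)) := by
    have := Real.add_one_le_exp (-(6 / 25) : ℝ); linarith
  have h0 : 0 ≤ μ.real {ω | Real.exp (-(6 / 25)) ≤ F ω} := measureReal_nonneg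
  nlinarith

end Gaussian

/-! ### One call of the power method -/

section Copy

variable {n : ℕ} {ε : ℝ}

/-- After `numIters n ε` power iterations, `n` eigenvalues below `1 - 3 ε` together weigh much less
than a single eigenvalue `1 - ε`. -/
lemma mul_pow_numIters_le (hn : 2 ≤ n) (h0 : 0 < ε) (h1 : ε < 1 / 40) :
    n * (1 - 3 * ε) ^ (2 * numIters n ε) ≤ ε / 100 * (1 - ε) ^ (2 * numIters n ε) := by
  set K := numIters n ε with hK
  have hn0 : (2 : ℝ) ≤ n := by exact_mod_cast hn
  have hr : 0 < ε / n := by positivity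
  have hr1 : ε / n ≤ 1 / 80 := by
    rw [div_le_iff₀ (by linarith)]; linarith
  have hKε : 4 * Real.log (n / ε) ≤ K * ε := by
    have := Nat.le_ceil (4 * Real.log (n / ε) / ε)
    rwa [div_le_iff₀ h0] at this
  have hlog : Real.log (n / ε) = -Real.log (ε / n) := by
    rw [← Real.log_inv, inv_div]
  have hexp : (1 - 2 * ε) ^ (2 * K) ≤ (ε / n) ^ 16 := by
    calc (1 - 2 * ε) ^ (2 * K) ≤ Real.exp (-(2 * ε)) ^ (2 * K) :=
          pow_le_pow_left₀ (by linarith) (Real.one_sub_le_exp_neg _) _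
      _ = Real.exp (-(4 * (K * ε))) := by
          rw [← Real.exp_nat_mul]; congr 1; push_cast; ring
      _ ≤ Real.exp (16 * Real.log (ε / n)) := Real.exp_le_exp.2 (by linarith)
      _ = (ε / n) ^ 16 := by
          rw [show (16 : ℝ) = (16 : ℕ) by norm_num, Real.exp_nat_mul, Real.exp_log hr]
  have h16 : n * (ε / n) ^ 16 ≤ ε / 100 := by
    have h2 : (ε / n) ^ 15 ≤ (ε / n) ^ 2 :=
      pow_le_pow_of_le_one hr.le (by linarith) (by norm_num)
    have h3 : n * (ε / n) ^ 16 = ε * (ε / n) ^ 15 := by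
      rw [pow_succ]; field_simp
    have h4 : (ε / n) ^ 2 ≤ 1 / 100 := by nlinarith
    rw [h3]
    nlinarith
  have hmul : (1 - 3 * ε) ^ (2 * K) ≤ (1 - ε) ^ (2 * K) * (1 - 2 * ε) ^ (2 * K) := by
    rw [← mul_pow]
    exact pow_le_pow_left₀ (by linarith) (by nlinarith) _
  have hp : 0 ≤ (1 - ε) ^ (2 * K) := pow_nonneg (by linarith) _
  calc n * (1 - 3 * ε) ^ (2 * K)
      ≤ n * ((1 - ε) ^ (2 * K) * (ε / n) ^ 16) := by
        have := mul_le_mul_of_nonneg_left hexp hp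
        exact mul_le_mul_of_nonneg_left (hmul.trans this) (by linarith)
    _ = (n * (ε / n) ^ 16) * (1 - ε) ^ (2 * K) := by ring
    _ ≤ _ := mul_le_mul_of_nonneg_right h16 hp

/-- The matrix of the quadratic form in `x` that can spoil the Rayleigh quotient of `A ^ m x` at
`B`: the loss from `A` to `B`, and the bound `c ^ (2 m)` for eigendirections of `A` below the
threshold `c`. This bound is charged to all directions, which keeps its trace simple. -/
noncomputable def spoilMatrix (A B : Matrix (Fin n) (Fin n) ℝ) (m : ℕ) (c : ℝ) :
    Matrix (Fin n) (Fin n) ℝ :=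
  c ^ (2 * m) • 1 + A ^ m * (A - B) * A ^ m

variable {A B : Matrix (Fin n) (Fin n) ℝ}

lemma quad_spoilMatrix (hA : A.IsHermitian) (m : ℕ) (c : ℝ) (x : Fin n → ℝ) :
    quad (spoilMatrix A B m c) x =
      c ^ (2 * m) * (x ⬝ᵥ x) + quad (A - B) (A ^ m *ᵥ x) := by
  rw [quad_mulVec_pow hA]
  simp [spoilMatrix, quad, add_mulVec, smul_mulVec, dotProduct_add]

lemma trace_spoilMatrix (m : ℕ) (c : ℝ) :
    (spoilMatrix A B m c).trace = n * c ^ (2 * m) + (A ^ (2 * m) * (A - B)).trace := by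
  rw [spoilMatrix, trace_add, trace_mul_comm (A ^ m * (A - B)), ← Matrix.mul_assoc, ← pow_add,
    two_mul]
  simp [mul_comm]

/-- The Rayleigh quotient of `A ^ m x` at `B` is at least `c`, up to the spoiling part. -/
lemma mul_quad_pow_sub_le (hA : A.PosSemidef) (m : ℕ) {c : ℝ} (hc : c ≤ 1) (x : Fin n → ℝ) :
    c * quad (A ^ (2 * m)) x - quad (spoilMatrix A B m c) x ≤ quad B (A ^ m *ᵥ x) := by
  have ha := hA.isHermitian
  rw [quad_spoilMatrix ha, quad_sub, quad_mulVec_pow ha A]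
  have h1 : A ^ m * A * A ^ m = A ^ (2 * m + 1) := by
    rw [← pow_succ, ← pow_add]; congr 1; ring
  rw [h1]
  suffices h : c * quad (A ^ (2 * m)) x - c ^ (2 * m) * (x ⬝ᵥ x) ≤ quad (A ^ (2 * m + 1)) x by
    linarith
  rw [quad_pow_eq ha, quad_pow_eq ha, dotProduct_self_eq ha, Finset.mul_sum, Finset.mul_sum,
    ← Finset.sum_sub_distrib]
  refine Finset.sum_le_sum fun k _ => ?_
  have hα := hA.eigenvalues_nonneg k
  set α := hA.isHermitian.eigenvalues k
  suffices h : c * α ^ (2 * m) - c ^ (2 * m) ≤ α ^ (2 * m + 1) by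
    have := mul_le_mul_of_nonneg_right h (sq_nonneg (eigenCoord ha x k))
    linarith
  have hp : 0 ≤ α ^ (2 * m) := pow_nonneg hα _
  have hcp : 0 ≤ c ^ (2 * m) := (even_two_mul m).pow_nonneg c
  rw [pow_succ]
  rcases le_or_gt c α with h | h
  · nlinarith
  · have h2 : α ^ (2 * m) ≤ c ^ (2 * m) := pow_le_pow_left₀ hα h.le _
    nlinarith [mul_nonneg hp hα]

/-- One copy succeeds with constant probability: if the trace of `A ^ (2 K + 1)` has not dropped by
a factor `1 - ε / 8` on the way from `A` to `B`, the vector computed from `A` still has Rayleigh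
quotient at least `1 - 40 ε` at `B`, except with probability `4 / 5`. The failures are a small
denominator, bounded by `measureReal_quad_pow_lt_le`, and a large spoiling part, bounded by
Markov's inequality. -/
lemma measureReal_quad_powerIterate_lt_le (hn : 2 ≤ n) (h0 : 0 < ε) (h1 : ε < 1 / 40)
    (hA : A.PosSemidef) (hB : B.PosSemidef) (hAB : (A - B).PosSemidef)
    (hle : ∀ k, hA.isHermitian.eigenvalues k ≤ 2) (hge : ∃ k, 1 - ε ≤ hA.isHermitian.eigenvalues k)
    (htr : (1 - ε / 8) * (A ^ (2 * numIters n ε + 1)).trace < (B ^ (2 * numIters n ε + 1)).trace)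
    {Ω : Type*} [MeasurableSpace Ω] {μ : Measure Ω} {x : Fin n → Ω → ℝ}
    (hx : ∀ i, HasLaw (x i) (gaussianReal 0 1) μ) (hi : iIndepFun x μ) :
    μ.real {ω | quad B (powerIterate ε A (fun i => x i ω)) < 1 - 40 * ε} ≤ 4 / 5 := by
  have := hi.isProbabilityMeasure
  have ha := hA.isHermitian
  set K := numIters n ε with hK
  set c := 1 - 3 * ε with hc
  set τ := (A ^ (2 * K)).trace with hτ
  have hτge : (1 - ε) ^ (2 * K) ≤ τ := by
    obtain ⟨k, hk⟩ := hge
    rw [hτ, trace_pow_eq ha]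
    refine (pow_le_pow_left₀ (by linarith) hk _).trans ?_
    exact Finset.single_le_sum (f := fun k => ha.eigenvalues k ^ (2 * K))
      (fun k _ => pow_nonneg (hA.eigenvalues_nonneg k) _) (Finset.mem_univ k)
  have hτ0 : 0 < τ := lt_of_lt_of_le (pow_pos (by linarith) _) hτge
  have htr1 : (A ^ (2 * K + 1)).trace ≤ 2 * τ := by
    rw [hτ, trace_pow_eq ha, trace_pow_eq ha, Finset.mul_sum]
    refine Finset.sum_le_sum fun k _ => ?_
    rw [pow_succ, mul_comm]
    exact mul_le_mul_of_nonneg_right (hle k) (pow_nonneg (hA.eigenvalues_nonneg k) _)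
  have hdrop := trace_pow_mul_sub_le hA hB hAB (2 * K)
  have htail := mul_pow_numIters_le hn h0 h1
  rw [← hK, ← hc] at htail
  set N := spoilMatrix A B K c with hN
  have hNtr : N.trace ≤ 3 / 10 * ε * τ := by
    rw [hN, trace_spoilMatrix]
    nlinarith
  have hN0 : ∀ y, 0 ≤ quad N y := fun y => by
    rw [hN, quad_spoilMatrix ha]
    have h2 : 0 ≤ y ⬝ᵥ y := dotProduct_self_star_nonneg y
    exact add_nonneg (mul_nonneg ((even_two_mul K).pow_nonneg c) h2) (quad_nonneg hAB _)
  have hmk := mul_meas_ge_le_integral_of_nonneg (μ := μ) (ae_of_all _ fun ω => hN0 fun i => x i ω)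
    (integrable_quad_gaussian hx N) (37 / 50 * ε * τ)
  rw [integral_quad_gaussian hx hi] at hmk
  have hbig : μ.real {ω | 37 / 50 * ε * τ ≤ quad N fun i => x i ω} ≤ 1 / 2 := by
    have h2 : 0 < ε * τ := mul_pos h0 hτ0
    by_contra! h3
    nlinarith
  have hsmall := measureReal_quad_pow_lt_le hx hi hA (2 * K) hτ0
  have hsub : {ω | quad B (powerIterate ε A (fun i => x i ω)) < 1 - 40 * ε} ⊆
      {ω | 37 / 50 * ε * τ ≤ quad N fun i => x i ω} ∪
        {ω | quad (A ^ (2 * K)) (fun i => x i ω) < τ / 50} := by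
    intro ω hω
    by_contra hcon
    simp only [Set.mem_union, Set.mem_ofPred_eq, not_or, not_le, not_lt] at hcon hω
    obtain ⟨h2, h3⟩ := hcon
    set y : Fin n → ℝ := fun i => x i ω
    have hden : (A ^ K *ᵥ y) ⬝ᵥ (A ^ K *ᵥ y) = quad (A ^ (2 * K)) y := by
      have := quad_mulVec_pow ha 1 K y
      rw [Matrix.mul_one, ← pow_add, ← two_mul, quad, one_mulVec] at this
      exact this
    rw [powerIterate, iterate_mulVec, quad_normalize, hden,
      div_lt_iff₀ (by linarith)] at hω
    have h4 := mul_quad_pow_sub_le (B := B) hA K (c := c) (by linarith) y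
    rw [← hN] at h4
    nlinarith
  have := measureReal_mono (μ := μ) hsub
  have := measureReal_union_le (μ := μ) {ω | 37 / 50 * ε * τ ≤ quad N fun i => x i ω}
    {ω | quad (A ^ (2 * K)) (fun i => x i ω) < τ / 50}
  linarith

/-- The failure probability `4 / 5` of one copy is amplified by the `numCopies n` copies to
at most `1 / (2 n)`. -/
lemma pow_numCopies_le (hn : 2 ≤ n) : (4 / 5 : ℝ) ^ numCopies n ≤ 1 / (2 * n) := by
  have hn0 : (2 : ℝ) ≤ n := by exact_mod_cast hn
  have hR : 10 * Real.log n ≤ numCopies n := Nat.le_ceil _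
  have h45 : (4 / 5 : ℝ) ≤ Real.exp (-(1 / 5)) := by
    have := Real.one_sub_le_exp_neg (1 / 5); linarith
  calc (4 / 5 : ℝ) ^ numCopies n ≤ Real.exp (-(1 / 5)) ^ numCopies n :=
        pow_le_pow_left₀ (by norm_num) h45 _
    _ = Real.exp (-(numCopies n / 5)) := by rw [← Real.exp_nat_mul]; congr 1; ring
    _ ≤ Real.exp (-(2 * Real.log n)) := Real.exp_le_exp.2 (by linarith)
    _ = 1 / n ^ 2 := by
        rw [Real.exp_neg, show (2 : ℝ) * Real.log n = (2 : ℕ) * Real.log n by norm_num,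
          Real.exp_nat_mul, Real.exp_log (by linarith), one_div]
    _ ≤ 1 / (2 * n) := one_div_le_one_div_of_le (by linarith) (by nlinarith)

end Copy

/-! ### Counting recomputations with the potential -/

section Counting

variable {n : ℕ} {ε : ℝ} {A₀ : Matrix (Fin n) (Fin n) ℝ} {v : ℕ → Fin n → ℝ} {T : ℕ}

/-- The condition under which an update with new matrix `A` recomputes: there is a current answer,
and all its vectors have Rayleigh quotient below `1 - 40 ε` at `A`. -/
def Triggers (ε : ℝ) (A : Matrix (Fin n) (Fin n) ℝ) (s : State n) : Prop :=
  ∃ i W, s.answer = some (i, W) ∧ ∀ r, quad A (W r) < 1 - 40 * ε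

lemma update_of_triggers {A : Matrix (Fin n) (Fin n) ℝ} {s : State n} (h : Triggers ε A s)
    (G : Vecs n) :
    update ε A G s = { answer := powerMethod ε A G, recomputations := s.recomputations + 1 } := by
  obtain ⟨i, W, hs, hW⟩ := h
  rw [update, hs]
  exact if_pos hW

lemma update_recomputations_of_not_triggers {A : Matrix (Fin n) (Fin n) ℝ} {s : State n}
    (h : ¬ Triggers ε A s) (G : Vecs n) :
    (update ε A G s).recomputations = s.recomputations := by
  rcases hs : s.answer with _ | ⟨i, W⟩
  · rw [update, hs]
  · rw [update, hs]
    have hW : ¬ ∀ r, quad A (W r) < 1 - 40 * ε := fun hW => h ⟨i, W, hs, hW⟩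
    simp only [if_neg hW]

lemma exists_answer_of_not_triggers {A : Matrix (Fin n) (Fin n) ℝ} {s : State n}
    (h : ¬ Triggers ε A s) {G : Vecs n} {i : ℕ} {W : Vecs n}
    (hW : (update ε A G s).answer = some (i, W)) : ∃ j, s.answer = some (j, W) := by
  rcases hs : s.answer with _ | ⟨j, W'⟩
  · rw [update, hs] at hW
    simp [hs] at hW
  · rw [update, hs] at hW
    have hW' : ¬ ∀ r, quad A (W' r) < 1 - 40 * ε := fun hW => h ⟨j, W', hs, hW⟩
    simp only [if_neg hW', Option.some.injEq, Prod.mk.injEq] at hW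
    exact ⟨j, by rw [hW.2]⟩

lemma powerMethod_eq_some {A : Matrix (Fin n) (Fin n) ℝ} {G : Vecs n} {i : ℕ} {W : Vecs n}
    (h : powerMethod ε A G = some (i, W)) :
    W = (fun r => powerIterate ε A (G r)) ∧ ∃ r, 1 - ε ≤ quad A (W r) := by
  simp only [powerMethod] at h
  split_ifs at h with hall
  simp only [Option.some.injEq, Prod.mk.injEq] at h
  refine ⟨h.2.symm, ?_⟩
  push Not at hall
  rw [← h.2]
  exact hall

/-- The potential at time `t`: the trace of the power `2 K + 1` of the current matrix. -/
noncomputable def potential (ε : ℝ) (A₀ : Matrix (Fin n) (Fin n) ℝ) (v : ℕ → Fin n → ℝ)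
    (t : ℕ) : ℝ :=
  (matrixAt A₀ v t ^ (2 * numIters n ε + 1)).trace

lemma matrixAt_sub_posSemidef {s t : ℕ} (hst : s ≤ t) :
    (matrixAt A₀ v s - matrixAt A₀ v t).PosSemidef := by
  induction t, hst using Nat.le_induction with
  | base => simpa using PosSemidef.zero
  | succ t _ ih =>
    have h := ih.add (posSemidef_vecMulVec_self_star (v (t + 1)))
    rw [star_trivial] at h
    convert h using 1
    rw [matrixAt]
    abel

lemma potential_le (hpsd : ∀ t ≤ T, (matrixAt A₀ v t).PosSemidef) {s t : ℕ} (hst : s ≤ t)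
    (ht : t ≤ T) : potential ε A₀ v t ≤ potential ε A₀ v s :=
  trace_pow_succ_le (hpsd s (hst.trans ht)) (hpsd t ht) (matrixAt_sub_posSemidef hst) _

lemma potential_nonneg (hpsd : ∀ t ≤ T, (matrixAt A₀ v t).PosSemidef) {t : ℕ} (ht : t ≤ T) :
    0 ≤ potential ε A₀ v t := ((hpsd t ht).pow _).trace_nonneg

/-- Initial vectors at time `s` with which the power method fails to make progress: it may return an
answer, but all vectors computed at time `s` are rejected at some time `t` when the potential has
not yet dropped by a factor `1 - ε / 8`. -/
def failureSet (ε : ℝ) (A₀ : Matrix (Fin n) (Fin n) ℝ) (v : ℕ → Fin n → ℝ) (T s : ℕ) :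
    Set (Vecs n) :=
  {G | (∃ w : Fin n → ℝ, w ⬝ᵥ w ≤ 1 ∧ 1 - ε ≤ quad (matrixAt A₀ v s) w) ∧
    ∃ t, s ≤ t ∧ t ≤ T ∧ (1 - ε / 8) * potential ε A₀ v s < potential ε A₀ v t ∧
      ∀ r, quad (matrixAt A₀ v t) (powerIterate ε (matrixAt A₀ v s) (G r)) < 1 - 40 * ε}

open Classical in
/-- The number of calls of the power method up to time `t`, the initial one included, whose initial
vectors are in the failure set. -/
noncomputable def failures (ε : ℝ) (A₀ : Matrix (Fin n) (Fin n) ℝ) (v : ℕ → Fin n → ℝ) (T : ℕ)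
    (G : ℕ → Vecs n) (t : ℕ) : ℕ :=
  (if G 0 ∈ failureSet ε A₀ v T 0 then 1 else 0) + ∑ s ∈ Finset.range t,
    if Triggers ε (matrixAt A₀ v (s + 1)) (run ε A₀ v G s) ∧
      G (s + 1) ∈ failureSet ε A₀ v T (s + 1) then 1 else 0

/-- One call of the power method pays for the next recomputation: at the time `t'` when the vectors
computed at time `t` are rejected, the potential has dropped by a factor `1 - ε / 8`, or the call
was a failure. -/
lemma potential_mul_pow_le (h0 : 0 < ε) (h1 : ε < 1)
    (hpsd : ∀ t ≤ T, (matrixAt A₀ v t).PosSemidef) {t t' : ℕ} (htt : t ≤ t') (ht' : t' ≤ T)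
    {G : Vecs n} {i : ℕ} {W : Vecs n} (hW : powerMethod ε (matrixAt A₀ v t) G = some (i, W))
    (hrej : ∀ r, quad (matrixAt A₀ v t') (W r) < 1 - 40 * ε) (d : ℕ)
    (hd : G ∈ failureSet ε A₀ v T t → d = 1) :
    potential ε A₀ v t' * (1 - ε / 8) ^ d ≤ (1 - ε / 8) * potential ε A₀ v t := by
  have hq0 : 0 ≤ 1 - ε / 8 := by linarith
  have hq1 : 1 - ε / 8 ≤ 1 := by linarith
  by_cases hG : G ∈ failureSet ε A₀ v T t
  · rw [hd hG, pow_one, mul_comm]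
    exact mul_le_mul_of_nonneg_left (potential_le hpsd htt ht') hq0
  · obtain ⟨rfl, r, hr⟩ := powerMethod_eq_some hW
    refine (mul_le_of_le_one_right (potential_nonneg hpsd ht') (pow_le_one₀ hq0 hq1)).trans ?_
    by_contra! hlt
    exact hG ⟨⟨_, normalize_dotProduct_self_le _, hr⟩, t', htt, ht', hlt, hrej⟩

lemma le_potential (h1 : ε < 1) (hpsd : ∀ t ≤ T, (matrixAt A₀ v t).PosSemidef) {t : ℕ} (ht : t ≤ T)
    {G : Vecs n} {i : ℕ} {W : Vecs n} (hW : powerMethod ε (matrixAt A₀ v t) G = some (i, W)) :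
    (1 - ε) ^ (2 * numIters n ε + 1) ≤ potential ε A₀ v t := by
  obtain ⟨rfl, r, hr⟩ := powerMethod_eq_some hW
  have ha := (hpsd t ht).isHermitian
  obtain ⟨k, hk⟩ := exists_le_eigenvalues ha (by linarith) (normalize_dotProduct_self_le _) hr
  rw [potential, trace_pow_eq ha]
  refine (pow_le_pow_left₀ (by linarith) hk _).trans ?_
  exact Finset.single_le_sum (f := fun k => ha.eigenvalues k ^ (2 * numIters n ε + 1))
    (fun k _ => pow_nonneg ((hpsd t ht).eigenvalues_nonneg k) _) (Finset.mem_univ k)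

/-- With `c` recomputations, `b` failures and `q = 1 - ε / 8`, the potential at the moment of the
next recomputation is at most `q ^ (c + 1 - b)` times the initial one. -/
lemma potential_mul_pow_failures_le (h0 : 0 < ε) (h1 : ε < 1)
    (hpsd : ∀ t ≤ T, (matrixAt A₀ v t).PosSemidef) (G : ℕ → Vecs n) {t : ℕ} (ht : t ≤ T)
    {i : ℕ} {W : Vecs n} (hW : (run ε A₀ v G t).answer = some (i, W)) {t' : ℕ} (htt : t ≤ t')
    (ht' : t' ≤ T) (hrej : ∀ r, quad (matrixAt A₀ v t') (W r) < 1 - 40 * ε) :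
    potential ε A₀ v t' * (1 - ε / 8) ^ failures ε A₀ v T G t ≤
      (1 - ε / 8) ^ ((run ε A₀ v G t).recomputations + 1) * potential ε A₀ v 0 := by
  have hq0 : 0 ≤ 1 - ε / 8 := by linarith
  induction t generalizing i W t' with
  | zero =>
    rw [run] at hW
    simpa [run] using potential_mul_pow_le h0 h1 hpsd htt ht' hW hrej (failures ε A₀ v T G 0)
      fun h => by simp [failures, h]
  | succ t ih =>
    have ih := @ih (by omega)
    by_cases htr : Triggers ε (matrixAt A₀ v (t + 1)) (run ε A₀ v G t)
    · rw [run, update_of_triggers htr] at hW ⊢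
      obtain ⟨j, W', hs, hW'⟩ := id htr
      have h2 := ih hs (Nat.le_succ t) ht hW'
      classical
      set d := if G (t + 1) ∈ failureSet ε A₀ v T (t + 1) then 1 else 0 with hd
      have hb : failures ε A₀ v T G (t + 1) = failures ε A₀ v T G t + d := by
        rw [failures, Finset.sum_range_succ, failures, hd]
        simp [htr, add_assoc]
      have h3 := potential_mul_pow_le h0 h1 hpsd htt ht' hW hrej d fun h => by simp [hd, h]
      have hp : 0 ≤ (1 - ε / 8) ^ failures ε A₀ v T G t := pow_nonneg hq0 _
      calc potential ε A₀ v t' * (1 - ε / 8) ^ failures ε A₀ v T G (t + 1)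
          = potential ε A₀ v t' * (1 - ε / 8) ^ d * (1 - ε / 8) ^ failures ε A₀ v T G t := by
            rw [hb]; ring
        _ ≤ (1 - ε / 8) * potential ε A₀ v (t + 1) * (1 - ε / 8) ^ failures ε A₀ v T G t :=
            mul_le_mul_of_nonneg_right h3 hp
        _ = (1 - ε / 8) * (potential ε A₀ v (t + 1) * (1 - ε / 8) ^ failures ε A₀ v T G t) := by
            ring
        _ ≤ (1 - ε / 8) * ((1 - ε / 8) ^ ((run ε A₀ v G t).recomputations + 1) *
              potential ε A₀ v 0) := mul_le_mul_of_nonneg_left h2 hq0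
        _ = _ := by ring
    · rw [run] at hW ⊢
      rw [update_recomputations_of_not_triggers htr]
      obtain ⟨j, hs⟩ := exists_answer_of_not_triggers htr hW
      have hb : failures ε A₀ v T G (t + 1) = failures ε A₀ v T G t := by
        rw [failures, Finset.sum_range_succ, failures]
        simp [htr]
      rw [hb]
      exact ih hs (by omega) ht' hrej

lemma failures_mono (G : ℕ → Vecs n) {s t : ℕ} (hst : s ≤ t) :
    failures ε A₀ v T G s ≤ failures ε A₀ v T G t := by
  classical
  rw [failures, failures]
  exact Nat.add_le_add_left (Finset.sum_le_sum_of_subset (Finset.range_subset_range.2 hst)) _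

/-- An answer certifies a potential of at least `(1 - ε) ^ (2 K + 1)`, and only the last
recomputation can fail to return one, so the drops of the potential are limited. -/
lemma pow_mul_pow_failures_le (h0 : 0 < ε) (h1 : ε < 1)
    (hpsd : ∀ t ≤ T, (matrixAt A₀ v t).PosSemidef) (G : ℕ → Vecs n) {t : ℕ} (ht : t ≤ T) :
    (run ε A₀ v G t).recomputations = 0 ∨
      (1 - ε) ^ (2 * numIters n ε + 1) * (1 - ε / 8) ^ (failures ε A₀ v T G t + 1) ≤
        (1 - ε / 8) ^ (run ε A₀ v G t).recomputations * potential ε A₀ v 0 := by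
  have hq0 : 0 ≤ 1 - ε / 8 := by linarith
  have hq1 : 1 - ε / 8 ≤ 1 := by linarith
  set P := (1 - ε) ^ (2 * numIters n ε + 1) with hP
  have hP0 : 0 ≤ P := pow_nonneg (by linarith) _
  have hanti : ∀ {a b : ℕ}, a ≤ b → (1 - ε / 8) ^ b ≤ (1 - ε / 8) ^ a :=
    fun h => pow_le_pow_of_le_one hq0 hq1 h
  -- While there is an answer, the bound holds without the additional factor `1 - ε / 8`.
  have main : ∀ t ≤ T, ((run ε A₀ v G t).answer ≠ none →
      P * (1 - ε / 8) ^ failures ε A₀ v T G t ≤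
        (1 - ε / 8) ^ (run ε A₀ v G t).recomputations * potential ε A₀ v 0) ∧
      ((run ε A₀ v G t).recomputations = 0 ∨ P * (1 - ε / 8) ^ (failures ε A₀ v T G t + 1) ≤
        (1 - ε / 8) ^ (run ε A₀ v G t).recomputations * potential ε A₀ v 0) := by
    intro t
    induction t with
    | zero =>
      intro ht
      refine ⟨fun hne => ?_, Or.inl rfl⟩
      obtain ⟨⟨i, W⟩, hW⟩ := Option.ne_none_iff_exists'.1 hne
      rw [run] at hW
      have h2 := le_potential h1 hpsd ht hW
      rw [run, pow_zero, one_mul]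
      exact (mul_le_of_le_one_right hP0 (pow_le_one₀ hq0 hq1)).trans h2
    | succ t ih =>
      intro ht
      obtain ⟨ih1, ih2⟩ := ih (by omega)
      have hmono : failures ε A₀ v T G t ≤ failures ε A₀ v T G (t + 1) :=
        failures_mono G (Nat.le_succ t)
      by_cases htr : Triggers ε (matrixAt A₀ v (t + 1)) (run ε A₀ v G t)
      · rw [run, update_of_triggers htr]
        obtain ⟨j, W, hs, hW⟩ := htr
        have h2 := potential_mul_pow_failures_le h0 h1 hpsd G (by omega) hs (Nat.le_succ t) ht hW
        refine ⟨fun hne => ?_, Or.inr ?_⟩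
        · obtain ⟨⟨i, W'⟩, hW'⟩ := Option.ne_none_iff_exists'.1 hne
          have h3 := le_potential h1 hpsd ht hW'
          calc P * (1 - ε / 8) ^ failures ε A₀ v T G (t + 1)
              ≤ P * (1 - ε / 8) ^ failures ε A₀ v T G t :=
                mul_le_mul_of_nonneg_left (hanti hmono) hP0
            _ ≤ potential ε A₀ v (t + 1) * (1 - ε / 8) ^ failures ε A₀ v T G t :=
                mul_le_mul_of_nonneg_right h3 (pow_nonneg hq0 _)
            _ ≤ _ := h2
        · have h3 := ih1 (by simp [hs])
          calc P * (1 - ε / 8) ^ (failures ε A₀ v T G (t + 1) + 1)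
              ≤ P * (1 - ε / 8) ^ (failures ε A₀ v T G t + 1) :=
                mul_le_mul_of_nonneg_left (hanti (by omega)) hP0
            _ = (1 - ε / 8) * (P * (1 - ε / 8) ^ failures ε A₀ v T G t) := by ring
            _ ≤ (1 - ε / 8) * ((1 - ε / 8) ^ (run ε A₀ v G t).recomputations *
                  potential ε A₀ v 0) := mul_le_mul_of_nonneg_left h3 hq0
            _ = _ := by ring
      · rw [run, update_recomputations_of_not_triggers htr]
        refine ⟨fun hne => ?_, ih2.imp id fun h => ?_⟩
        · obtain ⟨⟨i, W⟩, hW⟩ := Option.ne_none_iff_exists'.1 hne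
          obtain ⟨j, hs⟩ := exists_answer_of_not_triggers htr hW
          exact (mul_le_mul_of_nonneg_left (hanti hmono) hP0).trans (ih1 (by simp [hs]))
        · exact (mul_le_mul_of_nonneg_left (hanti (by omega)) hP0).trans h
  exact (main t ht).2

/-- The number of recomputations exceeds the number of failures by at most
`O (log (n / ε) / ε)`. -/
lemma recomputations_le_failures_add (hn : 2 ≤ n) (h0 : 0 < ε) (h1 : ε < 1 / 40)
    (hmax : lambdaMax A₀ ≤ 1 + ε / Real.log n)
    (hpsd : ∀ t ≤ T, (matrixAt A₀ v t).PosSemidef) (G : ℕ → Vecs n) {t : ℕ} (ht : t ≤ T) :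
    ((run ε A₀ v G t).recomputations : ℝ) ≤
      failures ε A₀ v T G t + 1 + 216 * Real.log (n / ε) / ε := by
  have hn0 : (2 : ℝ) ≤ n := by exact_mod_cast hn
  set ℓ := Real.log (n / ε) with hℓ
  have hdiv : (n : ℝ) ≤ n / ε := by rw [le_div_iff₀ h0]; nlinarith
  have hlog2 : 0.69 ≤ Real.log 2 := by linarith [Real.log_two_gt_d9]
  have hlogn : Real.log 2 ≤ Real.log n := Real.log_le_log (by norm_num) hn0
  have hℓn : Real.log n ≤ ℓ := Real.log_le_log (by linarith) hdiv
  have hℓ0 : 0 < ℓ := by linarith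
  have hrhs : 0 ≤ 216 * ℓ / ε := by positivity
  rcases pow_mul_pow_failures_le h0 (by linarith) hpsd G ht with hc | hmain
  · rw [hc]; push_cast
    have : (0 : ℝ) ≤ failures ε A₀ v T G t := Nat.cast_nonneg _
    linarith
  set c := (run ε A₀ v G t).recomputations
  set b := failures ε A₀ v T G t
  set p := 2 * numIters n ε + 1 with hp
  have hA := hpsd 0 (Nat.zero_le T)
  have hU : potential ε A₀ v 0 ≤ n * (1 + ε / Real.log n) ^ p := by
    rw [potential, trace_pow_eq hA.isHermitian]
    calc ∑ k, hA.isHermitian.eigenvalues k ^ p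
        ≤ ∑ _k : Fin n, (1 + ε / Real.log n) ^ p := Finset.sum_le_sum fun k _ =>
          pow_le_pow_left₀ (hA.eigenvalues_nonneg k)
            ((eigenvalues_le_lambdaMax hA.isHermitian k).trans hmax) _
      _ = _ := by simp
  have hq0 : 0 < 1 - ε / 8 := by linarith
  have hu : 0 < 1 + ε / Real.log n := by
    have : 0 < ε / Real.log n := div_pos h0 (by linarith)
    linarith
  have h2 := hmain.trans (mul_le_mul_of_nonneg_left hU (pow_nonneg hq0.le c))
  have h3 := Real.log_le_log (by
    have : 0 < 1 - ε := by linarith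
    positivity) h2
  rw [Real.log_mul (pow_ne_zero _ (by linarith)) (pow_ne_zero _ hq0.ne'),
    Real.log_mul (pow_ne_zero _ hq0.ne') (by positivity), Real.log_mul (by positivity)
    (by positivity), Real.log_pow, Real.log_pow, Real.log_pow, Real.log_pow] at h3
  have hq : Real.log (1 - ε / 8) ≤ -(ε / 8) := by
    have := Real.log_le_sub_one_of_pos hq0; linarith
  have hu1 : Real.log (1 + ε / Real.log n) ≤ 3 / 2 * ε := by
    have h4 := Real.log_le_sub_one_of_pos hu
    have h5 : ε / Real.log n ≤ 3 / 2 * ε := by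
      rw [div_le_iff₀ (by linarith)]; nlinarith
    linarith
  have hl1 : -(3 / 2 * ε) ≤ Real.log (1 - ε) := by
    have h4 := Real.one_sub_inv_le_log_of_pos (show 0 < 1 - ε by linarith)
    have h5 : (1 - ε)⁻¹ ≤ 1 + 3 / 2 * ε := by
      rw [inv_le_comm₀ (by linarith) (by positivity), inv_eq_one_div,
        div_le_iff₀ (by positivity)]
      nlinarith
    linarith
  have hpε : (p : ℝ) * ε ≤ 8 * ℓ + 3 * ε := by
    have h4 : (numIters n ε : ℝ) ≤ 4 * ℓ / ε + 1 :=
      (Nat.ceil_lt_add_one (by positivity)).le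
    have h5 := mul_le_mul_of_nonneg_right h4 h0.le
    rw [add_mul, div_mul_cancel₀ _ h0.ne'] at h5
    rw [hp]; push_cast; linarith
  have hp0 : (0 : ℝ) ≤ p := Nat.cast_nonneg _
  have h6 := mul_le_mul_of_nonneg_left hu1 hp0
  have h7 := mul_le_mul_of_nonneg_left hl1 hp0
  push_cast at h3
  by_contra! hlt
  have h8 : 0 ≤ (c : ℝ) - (b + 1) := by linarith
  have h9 := mul_le_mul_of_nonneg_left hq h8
  have h10 : 216 * ℓ < (c - (b + 1)) * ε := by
    rw [← div_lt_iff₀ h0]; linarith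
  linarith

end Counting

/-! ### Measurability of the algorithm and independence -/

section Measurability

variable {n : ℕ} {ε : ℝ}

lemma measurable_quad (A : Matrix (Fin n) (Fin n) ℝ) : Measurable (quad A) := by
  unfold quad dotProduct mulVec dotProduct
  fun_prop

lemma measurable_powerIterate (A : Matrix (Fin n) (Fin n) ℝ) : Measurable (powerIterate ε A) := by
  have h1 : Measurable fun x : Fin n → ℝ => A ^ numIters n ε *ᵥ x := by
    unfold mulVec dotProduct
    fun_prop
  have h2 : Measurable fun x : Fin n → ℝ => x ⬝ᵥ x := by
    unfold dotProduct
    fun_prop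
  have h3 : Measurable (normalize : (Fin n → ℝ) → Fin n → ℝ) := by
    unfold normalize
    exact h2.sqrt.inv.smul measurable_id
  have h4 : powerIterate ε A = fun x => normalize (A ^ numIters n ε *ᵥ x) := by
    funext x
    rw [powerIterate, iterate_mulVec]
  rw [h4]
  exact h3.comp h1

lemma measurableSet_quad_powerIterate_lt (A B : Matrix (Fin n) (Fin n) ℝ) (c : ℝ) :
    MeasurableSet {x | quad B (powerIterate ε A x) < c} :=
  measurableSet_lt ((measurable_quad B).comp (measurable_powerIterate A)) measurable_const

/-- A state seen as a point of a measurable space: whether there is an answer, the vectors of the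
answer (`0` if there is none), and the number of recomputations. The index in the answer does not
influence later states and is left out. -/
def encode (s : State n) : Bool × Vecs n × ℕ :=
  match s.answer with
  | none => (false, 0, s.recomputations)
  | some (_, W) => (true, W, s.recomputations)

lemma triggers_iff_encode {A : Matrix (Fin n) (Fin n) ℝ} {s : State n} :
    Triggers ε A s ↔ (encode s).1 = true ∧ ∀ r, quad A ((encode s).2.1 r) < 1 - 40 * ε := by
  rcases hs : s.answer with _ | ⟨i, W⟩ <;> simp [Triggers, encode, hs]

lemma encode_recomputations (s : State n) : (encode s).2.2 = s.recomputations := by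
  rcases hs : s.answer with _ | ⟨i, W⟩ <;> simp [encode, hs]

lemma encode_update_of_not_triggers {A : Matrix (Fin n) (Fin n) ℝ} {s : State n}
    (h : ¬ Triggers ε A s) (G : Vecs n) : encode (update ε A G s) = encode s := by
  rcases hs : s.answer with _ | ⟨i, W⟩
  · rw [update, hs]
  · rw [update, hs]
    have hW : ¬ ∀ r, quad A (W r) < 1 - 40 * ε := fun hW => h ⟨i, W, hs, hW⟩
    simp only [if_neg hW, encode, hs]

open Classical in
lemma encode_powerMethod (A : Matrix (Fin n) (Fin n) ℝ) (G : Vecs n) (k : ℕ) :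
    encode { answer := powerMethod ε A G, recomputations := k } =
      if ∀ r, quad A (powerIterate ε A (G r)) < 1 - ε then (false, 0, k)
      else (true, fun r => powerIterate ε A (G r), k) := by
  by_cases h : ∀ r, quad A (powerIterate ε A (G r)) < 1 - ε
  · simp only [encode, powerMethod, if_pos h]
  · simp only [encode, powerMethod, if_neg h]

variable {Y : Type*} [MeasurableSpace Y]

lemma measurable_encode_powerMethod (A : Matrix (Fin n) (Fin n) ℝ) {G : Y → Vecs n}
    (hG : Measurable G) {k : Y → ℕ} (hk : Measurable k) :
    Measurable fun y =>
      encode { answer := powerMethod ε A (G y), recomputations := k y } := by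
  classical
  simp only [encode_powerMethod]
  have hP : ∀ r, Measurable fun y => powerIterate ε A (G y r) := fun r =>
    (measurable_powerIterate A).comp ((measurable_pi_apply r).comp hG)
  refine Measurable.ite ?_ (by fun_prop) ?_
  · rw [Set.ofPred_forall]
    exact MeasurableSet.iInter fun r =>
      measurableSet_lt ((measurable_quad A).comp (hP r)) measurable_const
  · exact measurable_const.prodMk ((measurable_pi_lambda _ hP).prodMk hk)

lemma measurableSet_triggers (A : Matrix (Fin n) (Fin n) ℝ) {s : Y → State n}
    (hs : Measurable fun y => encode (s y)) : MeasurableSet {y | Triggers ε A (s y)} := by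
  simp only [triggers_iff_encode]
  have h1 : MeasurableSet {y | (encode (s y)).1 = true} :=
    (measurable_fst.comp hs) (measurableSet_singleton true)
  have h2 : ∀ r, MeasurableSet {y | quad A ((encode (s y)).2.1 r) < 1 - 40 * ε} := fun r =>
    measurableSet_lt ((measurable_quad A).comp ((measurable_pi_apply r).comp
      (measurable_fst.comp (measurable_snd.comp hs)))) measurable_const
  have h3 := h1.inter (MeasurableSet.iInter h2)
  convert h3 using 1
  ext y
  simp

lemma measurable_encode_run (A₀ : Matrix (Fin n) (Fin n) ℝ) (v : ℕ → Fin n → ℝ)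
    {G : Y → ℕ → Vecs n} (hG : Measurable G) (t : ℕ) :
    Measurable fun y => encode (run ε A₀ v (G y) t) := by
  classical
  induction t with
  | zero =>
    have h : (fun y => encode (run ε A₀ v (G y) 0)) = fun y =>
        encode { answer := powerMethod ε A₀ (G y 0), recomputations := 0 } := by
      funext y
      rw [run]
    have hG0 : Measurable fun y => G y 0 := (measurable_pi_apply 0).comp hG
    rw [h]
    exact measurable_encode_powerMethod A₀ hG0 (k := fun _ => 0) measurable_const
  | succ t ih =>
    set A := matrixAt A₀ v (t + 1)
    have h : (fun y => encode (run ε A₀ v (G y) (t + 1))) = fun y =>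
        if Triggers ε A (run ε A₀ v (G y) t) then
          encode { answer := powerMethod ε A (G y (t + 1))
                   recomputations := (encode (run ε A₀ v (G y) t)).2.2 + 1 }
        else encode (run ε A₀ v (G y) t) := by
      funext y
      rw [run]
      split_ifs with htr
      · rw [update_of_triggers htr, encode_recomputations]
      · exact encode_update_of_not_triggers htr _
    rw [h]
    refine Measurable.ite (measurableSet_triggers A ih) ?_ ih
    have hGt : Measurable fun y => G y (t + 1) := (measurable_pi_apply (t + 1)).comp hG
    have hk : Measurable fun y => (encode (run ε A₀ v (G y) t)).2.2 + 1 :=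
      (measurable_snd.comp (measurable_snd.comp ih)).add_const 1
    exact measurable_encode_powerMethod A hGt hk

lemma measurableSet_triggers_and_recomputations_lt (A A₀ : Matrix (Fin n) (Fin n) ℝ)
    (v : ℕ → Fin n → ℝ) {G : Y → ℕ → Vecs n} (hG : Measurable G) (t M : ℕ) :
    MeasurableSet {y | Triggers ε A (run ε A₀ v (G y) t) ∧
      (run ε A₀ v (G y) t).recomputations < M} := by
  have henc := measurable_encode_run (ε := ε) A₀ v hG t
  have h := (measurable_snd.comp (measurable_snd.comp henc)) (measurableSet_Iio (a := M))
  have heq : {y | Triggers ε A (run ε A₀ v (G y) t) ∧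
      (run ε A₀ v (G y) t).recomputations < M} = {y | Triggers ε A (run ε A₀ v (G y) t)} ∩
      (Prod.snd ∘ Prod.snd ∘ fun y => encode (run ε A₀ v (G y) t)) ⁻¹' Set.Iio M := by
    ext y
    simp [encode_recomputations]
  rw [heq]
  exact (measurableSet_triggers A henc).inter h

lemma run_congr {A₀ : Matrix (Fin n) (Fin n) ℝ} {v : ℕ → Fin n → ℝ} {G G' : ℕ → Vecs n} {t : ℕ}
    (h : ∀ s ≤ t, G s = G' s) : run ε A₀ v G t = run ε A₀ v G' t := by
  induction t with
  | zero => rw [run, run, h 0 le_rfl]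
  | succ t ih => rw [run, run, h (t + 1) le_rfl, ih fun s hs => h s (by omega)]

lemma measurableSet_failureSet (A₀ : Matrix (Fin n) (Fin n) ℝ) (v : ℕ → Fin n → ℝ) (T s : ℕ) :
    MeasurableSet (failureSet ε A₀ v T s) := by
  have h : failureSet ε A₀ v T s =
      {_G | ∃ w : Fin n → ℝ, w ⬝ᵥ w ≤ 1 ∧ 1 - ε ≤ quad (matrixAt A₀ v s) w} ∩
        ⋃ t, {_G | s ≤ t ∧ t ≤ T ∧ (1 - ε / 8) * potential ε A₀ v s < potential ε A₀ v t} ∩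
          ⋂ r, (fun G : Vecs n => G r) ⁻¹'
            {x | quad (matrixAt A₀ v t) (powerIterate ε (matrixAt A₀ v s) x) < 1 - 40 * ε} := by
    ext G
    simp only [failureSet, Set.mem_ofPred_eq, Set.mem_inter_iff, Set.mem_iUnion, Set.mem_iInter,
      Set.mem_preimage, and_assoc]
  rw [h]
  exact (MeasurableSet.const _).inter (MeasurableSet.iUnion fun t =>
    (MeasurableSet.const _).inter (MeasurableSet.iInter fun r =>
      measurable_pi_apply r (measurableSet_quad_powerIterate_lt _ _ _)))

end Measurability

section Independence

variable {Ω : Type*} [MeasurableSpace Ω] {μ : Measure Ω}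

/-- For a family of independent real random variables, two events that depend on disjoint finite
sets of coordinates are independent. -/
lemma measureReal_inter_eq_mul_of_disjoint {ι : Type*} {g : ι → Ω → ℝ} (hg : ∀ j, Measurable (g j))
    (hi : iIndepFun g μ) {S T : Finset ι} (hST : Disjoint S T) {E F : Set (ι → ℝ)}
    (hE : MeasurableSet E) (hF : MeasurableSet F)
    (hES : ∀ y z : ι → ℝ, (∀ j ∈ S, y j = z j) → (y ∈ E ↔ z ∈ E))
    (hFT : ∀ y z : ι → ℝ, (∀ j ∈ T, y j = z j) → (y ∈ F ↔ z ∈ F)) :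
    μ.real {ω | (fun j => g j ω) ∈ E ∧ (fun j => g j ω) ∈ F} =
      μ.real {ω | (fun j => g j ω) ∈ E} * μ.real {ω | (fun j => g j ω) ∈ F} := by
  classical
  -- Both events are preimages under the tuples over `S` and `T`, extended by `0`.
  let e : (U : Finset ι) → (U → ℝ) → ι → ℝ := fun U y j => if h : j ∈ U then y ⟨j, h⟩ else 0
  have he : ∀ U, Measurable (e U) := fun U => measurable_pi_lambda _ fun j => by
    by_cases h : j ∈ U
    · simpa [e, h] using measurable_pi_apply _
    · simp [e, h]
  have hE' : {ω | (fun j => g j ω) ∈ E} = (fun ω (j : S) => g j ω) ⁻¹' (e S ⁻¹' E) := by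
    ext ω
    exact hES _ _ fun j hj => by simp [e, hj]
  have hF' : {ω | (fun j => g j ω) ∈ F} = (fun ω (j : T) => g j ω) ⁻¹' (e T ⁻¹' F) := by
    ext ω
    exact hFT _ _ fun j hj => by simp [e, hj]
  have h := (hi.indepFun_finset S T hST hg).measure_inter_preimage_eq_mul _ _ (he S hE) (he T hF)
  rw [← hE', ← hF'] at h
  have h' := congrArg ENNReal.toReal h
  rwa [ENNReal.toReal_mul] at h'

end Independence

/-! ### Failures of the power method are rare -/

section Probability

variable {n : ℕ} {ε : ℝ} {A₀ : Matrix (Fin n) (Fin n) ℝ} {v : ℕ → Fin n → ℝ} {T : ℕ}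

/-- The initial vectors at all times, read off from a single family of real numbers. -/
def initialVecs (y : ℕ × Fin (numCopies n) × Fin n → ℝ) : ℕ → Vecs n := fun t r i => y (t, r, i)

lemma measurable_initialVecs : Measurable (initialVecs (n := n)) :=
  measurable_pi_lambda _ fun _ => measurable_pi_lambda _ fun _ => measurable_pi_lambda _ fun _ =>
    measurable_pi_apply _

variable {Ω : Type*} [MeasurableSpace Ω] {μ : Measure Ω}
  {g : ℕ × Fin (numCopies n) × Fin n → Ω → ℝ}

lemma measureReal_forall_mem_le (hg : ∀ j, Measurable (g j)) (hi : iIndepFun g μ) (s : ℕ)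
    {B : Set (Fin n → ℝ)} (hB : MeasurableSet B) {c : ℝ} (hc : 0 ≤ c)
    (h : ∀ r, μ.real {ω | (fun i => g (s, r, i) ω) ∈ B} ≤ c) (S : Finset (Fin (numCopies n))) :
    μ.real {ω | ∀ r ∈ S, (fun i => g (s, r, i) ω) ∈ B} ≤ c ^ S.card := by
  classical
  have := hi.isProbabilityMeasure
  have hmeas : ∀ r, MeasurableSet
      {y : ℕ × Fin (numCopies n) × Fin n → ℝ | (fun i => y (s, r, i)) ∈ B} := fun r =>
    (measurable_pi_lambda _ fun i => measurable_pi_apply (s, r, i)) hB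
  induction S using Finset.induction_on with
  | empty => simp
  | insert a S ha ih =>
    have hind := measureReal_inter_eq_mul_of_disjoint hg hi
      (S := {s} ×ˢ ({a} ×ˢ Finset.univ)) (T := {s} ×ˢ (S ×ˢ Finset.univ))
      (E := {y | (fun i => y (s, a, i)) ∈ B}) (F := ⋂ r ∈ S, {y | (fun i => y (s, r, i)) ∈ B})
      (by
        rw [Finset.disjoint_left]
        rintro ⟨s', r, i⟩ h1 h2
        simp only [Finset.mem_product, Finset.mem_singleton, Finset.mem_univ, and_true] at h1 h2
        exact ha (h1.2 ▸ h2.2))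
      (hmeas a) (Finset.measurableSet_biInter S fun r _ => hmeas r)
      (fun y z hyz => by
        have : (fun i => y (s, a, i)) = fun i => z (s, a, i) :=
          funext fun i => hyz _ (by simp)
        simp only [Set.mem_ofPred_eq, this])
      (fun y z hyz => by
        have : ∀ r ∈ S, (fun i => y (s, r, i)) = fun i => z (s, r, i) := fun r hr =>
          funext fun i => hyz _ (by simp [hr])
        simp only [Set.mem_iInter, Set.mem_ofPred_eq]
        exact forall₂_congr fun r hr => by rw [this r hr])
    simp only [Set.mem_iInter, Set.mem_ofPred_eq] at hind
    simp only [Finset.forall_mem_insert]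
    rw [hind, Finset.card_insert_of_notMem ha, pow_succ, mul_comm]
    exact mul_le_mul ih (h a) measureReal_nonneg (pow_nonneg hc _)

/-- A call of the power method fails with probability at most `1 / (2 n)`. -/
lemma measureReal_failureSet_le (hn : 2 ≤ n) (h0 : 0 < ε) (h1 : ε < 1 / 40)
    (hmax : lambdaMax A₀ ≤ 1 + ε / Real.log n)
    (hpsd : ∀ t ≤ T, (matrixAt A₀ v t).PosSemidef)
    (hg : ∀ j, Measurable (g j)) (hlaw : ∀ j, HasLaw (g j) (gaussianReal 0 1) μ)
    (hi : iIndepFun g μ) (s : ℕ) :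
    μ.real {ω | initialVecs (fun j => g j ω) s ∈ failureSet ε A₀ v T s} ≤ 1 / (2 * n) := by
  classical
  have := hi.isProbabilityMeasure
  rcases Set.eq_empty_or_nonempty (failureSet ε A₀ v T s) with hem | ⟨G₀, hw, t₀, hst₀, ht₀, hP₀, -⟩
  · simp only [hem, Set.mem_empty_iff_false, Set.ofPred_false, measureReal_empty]
    positivity
  have hsT := hst₀.trans ht₀
  -- Rejection at the last time `t` before the potential has dropped is implied by rejection at any
  -- earlier time, since Rayleigh quotients only decrease.
  set P : ℕ → Prop := fun t =>
    s ≤ t ∧ (1 - ε / 8) * potential ε A₀ v s < potential ε A₀ v t with hP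
  set t := Nat.findGreatest P T with ht
  obtain ⟨hst, hpot⟩ : P t := Nat.findGreatest_spec ht₀ ⟨hst₀, hP₀⟩
  have htT : t ≤ T := Nat.findGreatest_le T
  set As := matrixAt A₀ v s with hAs
  set At := matrixAt A₀ v t with hAt
  have hA := hpsd s hsT
  have hsub : {ω | initialVecs (fun j => g j ω) s ∈ failureSet ε A₀ v T s} ⊆
      {ω | ∀ r ∈ Finset.univ, (fun i => g (s, r, i) ω) ∈
        {x | quad At (powerIterate ε As x) < 1 - 40 * ε}} := by
    rintro ω ⟨-, t', hst', ht', hpot', hrej⟩ r -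
    have htt : t' ≤ t := Nat.le_findGreatest ht' ⟨hst', hpot'⟩
    have h2 := quad_nonneg (matrixAt_sub_posSemidef (A₀ := A₀) (v := v) htt)
      (powerIterate ε As fun i => g (s, r, i) ω)
    rw [quad_sub] at h2
    exact lt_of_le_of_lt (sub_nonneg.1 h2) (hrej r)
  have hle : ∀ k, hA.isHermitian.eigenvalues k ≤ 2 := fun k => by
    have hn0 : (2 : ℝ) ≤ n := by exact_mod_cast hn
    have h2 : hA.isHermitian.eigenvalues k ≤ lambdaMax A₀ :=
      eigenvalues_le_lambdaMax_of_le (hpsd 0 (Nat.zero_le T)) hA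
        (matrixAt_sub_posSemidef (A₀ := A₀) (v := v) (Nat.zero_le s)) k
    have hlog2 : 0.69 ≤ Real.log 2 := by linarith [Real.log_two_gt_d9]
    have hlogn : Real.log 2 ≤ Real.log n := Real.log_le_log (by norm_num) hn0
    have h5 : ε / Real.log n ≤ 1 := by rw [div_le_one (by linarith)]; linarith
    linarith
  have hge : ∃ k, 1 - ε ≤ hA.isHermitian.eigenvalues k := by
    obtain ⟨w, hw1, hw2⟩ := hw
    exact exists_le_eigenvalues _ (by linarith) hw1 hw2
  have hone : ∀ r, μ.real {ω | (fun i => g (s, r, i) ω) ∈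
      {x | quad At (powerIterate ε As x) < 1 - 40 * ε}} ≤ 4 / 5 := fun r => by
    refine measureReal_quad_powerIterate_lt_le hn h0 h1 hA (hpsd t htT)
      (matrixAt_sub_posSemidef hst) hle hge hpot (fun i => hlaw (s, r, i)) ?_
    exact hi.precomp (g := fun i => (s, r, i)) fun i j hij => by simpa using hij
  refine (measureReal_mono hsub).trans ?_
  refine (measureReal_forall_mem_le hg hi s (measurableSet_quad_powerIterate_lt _ _ _)
    (by norm_num) hone Finset.univ).trans ?_
  rw [Finset.card_univ, Fintype.card_fin]
  exact pow_numCopies_le hn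

/-- Whether time `s + 1` recomputes is decided by the past, so it is independent of whether the
fresh initial vectors of time `s + 1` fail. -/
lemma measureReal_triggers_and_failure_eq (hg : ∀ j, Measurable (g j)) (hi : iIndepFun g μ)
    (s M : ℕ) :
    μ.real {ω | (Triggers ε (matrixAt A₀ v (s + 1))
        (run ε A₀ v (initialVecs fun j => g j ω) s) ∧
        (run ε A₀ v (initialVecs fun j => g j ω) s).recomputations < M) ∧
        initialVecs (fun j => g j ω) (s + 1) ∈ failureSet ε A₀ v T (s + 1)} =
      μ.real {ω | Triggers ε (matrixAt A₀ v (s + 1))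
        (run ε A₀ v (initialVecs fun j => g j ω) s) ∧
        (run ε A₀ v (initialVecs fun j => g j ω) s).recomputations < M} *
      μ.real {ω | initialVecs (fun j => g j ω) (s + 1) ∈ failureSet ε A₀ v T (s + 1)} := by
  classical
  refine measureReal_inter_eq_mul_of_disjoint hg hi
    (S := Finset.range (s + 1) ×ˢ Finset.univ) (T := {s + 1} ×ˢ Finset.univ)
    (E := {y | Triggers ε (matrixAt A₀ v (s + 1)) (run ε A₀ v (initialVecs y) s) ∧
        (run ε A₀ v (initialVecs y) s).recomputations < M})
    (F := {y | initialVecs y (s + 1) ∈ failureSet ε A₀ v T (s + 1)}) ?_ ?_ ?_ ?_ ?_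
  · rw [Finset.disjoint_left]
    rintro ⟨s', r, i⟩ h1 h2
    simp only [Finset.mem_product, Finset.mem_singleton, Finset.mem_range, Finset.mem_univ,
      and_true] at h1 h2
    omega
  · exact measurableSet_triggers_and_recomputations_lt _ A₀ v measurable_initialVecs s M
  · exact ((measurable_pi_apply (s + 1)).comp measurable_initialVecs)
      (measurableSet_failureSet A₀ v T (s + 1))
  · intro y z hyz
    have h : run ε A₀ v (initialVecs y) s = run ε A₀ v (initialVecs z) s :=
      run_congr fun t ht => by
        funext r i
        exact hyz _ (by simp; omega)
    simp only [Set.mem_ofPred_eq, h]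
  · intro y z hyz
    have h : initialVecs y (s + 1) = initialVecs z (s + 1) := by
      funext r i
      exact hyz _ (by simp)
    simp only [Set.mem_ofPred_eq, h]

open Classical in
lemma sum_triggers_eq_min (G : ℕ → Vecs n) (M t : ℕ) :
    (∑ s ∈ Finset.range t, if Triggers ε (matrixAt A₀ v (s + 1)) (run ε A₀ v G s) ∧
      (run ε A₀ v G s).recomputations < M then 1 else 0) =
      min (run ε A₀ v G t).recomputations M := by
  induction t with
  | zero => simp [run]
  | succ t ih =>
    rw [Finset.sum_range_succ, ih, run]
    by_cases htr : Triggers ε (matrixAt A₀ v (t + 1)) (run ε A₀ v G t)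
    · rw [update_of_triggers htr]
      simp only [htr, true_and]
      split_ifs <;> omega
    · rw [update_recomputations_of_not_triggers htr]
      simp [htr]

open Classical in
/-- The number of failures among the initial call and the first `M` recomputations, up to
time `T`. -/
noncomputable def earlyFailures (ε : ℝ) (A₀ : Matrix (Fin n) (Fin n) ℝ) (v : ℕ → Fin n → ℝ)
    (T M : ℕ) (G : ℕ → Vecs n) : ℝ :=
  (if G 0 ∈ failureSet ε A₀ v T 0 then 1 else 0) + ∑ s ∈ Finset.range T,
    if (Triggers ε (matrixAt A₀ v (s + 1)) (run ε A₀ v G s) ∧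
      (run ε A₀ v G s).recomputations < M) ∧
      G (s + 1) ∈ failureSet ε A₀ v T (s + 1) then 1 else 0

lemma exists_recomputations_eq (G : ℕ → Vecs n) {M T : ℕ}
    (h : M < (run ε A₀ v G T).recomputations) :
    ∃ t ≤ T, (run ε A₀ v G t).recomputations = M := by
  induction T with
  | zero => simp [run] at h
  | succ T ih =>
    by_cases hT : M < (run ε A₀ v G T).recomputations
    · obtain ⟨t, ht, he⟩ := ih hT
      exact ⟨t, by omega, he⟩
    · refine ⟨T, by omega, ?_⟩
      rw [run] at h
      by_cases htr : Triggers ε (matrixAt A₀ v (T + 1)) (run ε A₀ v G T)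
      · rw [update_of_triggers htr] at h
        simp only at h
        omega
      · rw [update_recomputations_of_not_triggers htr] at h
        omega

lemma recomputations_mono (G : ℕ → Vecs n) {s t : ℕ} (hst : s ≤ t) :
    (run ε A₀ v G s).recomputations ≤ (run ε A₀ v G t).recomputations := by
  induction t, hst using Nat.le_induction with
  | base => exact le_rfl
  | succ t _ ih =>
    refine ih.trans ?_
    rw [run]
    by_cases htr : Triggers ε (matrixAt A₀ v (t + 1)) (run ε A₀ v G t)
    · rw [update_of_triggers htr]; exact Nat.le_succ _
    · rw [update_recomputations_of_not_triggers htr]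

lemma failures_le_earlyFailures (G : ℕ → Vecs n) {M t : ℕ} (ht : t ≤ T)
    (hM : (run ε A₀ v G t).recomputations = M) :
    (failures ε A₀ v T G t : ℝ) ≤ earlyFailures ε A₀ v T M G := by
  classical
  rw [failures, earlyFailures]
  push_cast
  refine add_le_add le_rfl ?_
  refine (Finset.sum_le_sum fun s hs => ?_).trans
    (Finset.sum_le_sum_of_subset_of_nonneg (Finset.range_subset_range.2 ht) fun s _ _ => by
      split_ifs <;> norm_num)
  by_cases htr : Triggers ε (matrixAt A₀ v (s + 1)) (run ε A₀ v G s)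
  · have h1 : (run ε A₀ v G (s + 1)).recomputations = (run ε A₀ v G s).recomputations + 1 := by
      rw [run, update_of_triggers htr]
    have h2 := recomputations_mono (ε := ε) (A₀ := A₀) (v := v) G
      (Nat.succ_le_of_lt (Finset.mem_range.1 hs))
    have h3 : (run ε A₀ v G s).recomputations < M := by
      rw [Nat.succ_eq_add_one] at h2; omega
    simp [htr, h3]
  · simp [htr]

/-- The expected number of failures among the first calls is at most the number of calls times
the failure probability of one call. -/
lemma integral_earlyFailures_le (hg : ∀ j, Measurable (g j)) (hi : iIndepFun g μ) {p : ℝ}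
    (hp : ∀ s, μ.real {ω | initialVecs (fun j => g j ω) s ∈ failureSet ε A₀ v T s} ≤ p) (M : ℕ) :
    Integrable (fun ω => earlyFailures ε A₀ v T M (initialVecs fun j => g j ω)) μ ∧
      ∫ ω, earlyFailures ε A₀ v T M (initialVecs fun j => g j ω) ∂μ ≤ p * (M + 1) := by
  classical
  have := hi.isProbabilityMeasure
  have hp0 : 0 ≤ p := measureReal_nonneg.trans (hp 0)
  have hG : Measurable fun ω => initialVecs (n := n) fun j => g j ω :=
    measurable_initialVecs.comp (measurable_pi_lambda _ hg)
  set F : ℕ → Set Ω := fun s => {ω | initialVecs (fun j => g j ω) s ∈ failureSet ε A₀ v T s}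
  set E : ℕ → Set Ω := fun s => {ω | Triggers ε (matrixAt A₀ v (s + 1))
        (run ε A₀ v (initialVecs fun j => g j ω) s) ∧
        (run ε A₀ v (initialVecs fun j => g j ω) s).recomputations < M}
  have hF : ∀ s, MeasurableSet (F s) := fun s =>
    ((measurable_pi_apply s).comp hG) (measurableSet_failureSet A₀ v T s)
  have hE : ∀ s, MeasurableSet (E s) := fun s =>
    measurableSet_triggers_and_recomputations_lt _ A₀ v hG s M
  have hint : ∀ {S : Set Ω}, MeasurableSet S →
      Integrable (S.indicator fun _ => (1 : ℝ)) μ := fun hS =>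
    (integrable_const 1).indicator hS
  have hone : ∀ {S : Set Ω}, MeasurableSet S →
      ∫ ω, S.indicator (fun _ => (1 : ℝ)) ω ∂μ = μ.real S := fun hS => integral_indicator_one hS
  have heq : (fun ω => earlyFailures ε A₀ v T M (initialVecs fun j => g j ω)) = fun ω =>
      (F 0).indicator (fun _ => (1 : ℝ)) ω +
        ∑ s ∈ Finset.range T, (E s ∩ F (s + 1)).indicator (fun _ => (1 : ℝ)) ω := by
    funext ω
    simp only [earlyFailures, Set.indicator_apply]
    rfl
  have hsum : ∑ s ∈ Finset.range T, μ.real (E s) ≤ M := by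
    have h1 : ∑ s ∈ Finset.range T, μ.real (E s) =
        ∫ ω, ∑ s ∈ Finset.range T, (E s).indicator (fun _ => (1 : ℝ)) ω ∂μ := by
      rw [integral_finsetSum _ fun s _ => hint (hE s)]
      exact Finset.sum_congr rfl fun s _ => (hone (hE s)).symm
    rw [h1]
    have h2 : ∀ ω, ∑ s ∈ Finset.range T, (E s).indicator (fun _ => (1 : ℝ)) ω ≤ M := fun ω => by
      have h3 := sum_triggers_eq_min (ε := ε) (A₀ := A₀) (v := v)
        (initialVecs fun j => g j ω) M T
      have h4 : ∑ s ∈ Finset.range T, (E s).indicator (fun _ => (1 : ℝ)) ω =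
          ((min (run ε A₀ v (initialVecs fun j => g j ω) T).recomputations M : ℕ) : ℝ) := by
        rw [← h3]
        push_cast
        exact Finset.sum_congr rfl fun s _ => by simp only [Set.indicator_apply]; rfl
      rw [h4]
      exact_mod_cast min_le_right _ _
    calc _ ≤ ∫ _ω, (M : ℝ) ∂μ :=
          integral_mono (integrable_finsetSum _ fun s _ => hint (hE s)) (integrable_const _) h2
      _ = M := by simp
  rw [heq]
  have hi2 : Integrable (fun ω => ∑ s ∈ Finset.range T,
      (E s ∩ F (s + 1)).indicator (fun _ => (1 : ℝ)) ω) μ :=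
    integrable_finsetSum _ fun s _ => hint ((hE s).inter (hF (s + 1)))
  refine ⟨(hint (hF 0)).add hi2, ?_⟩
  rw [integral_add (hint (hF 0)) hi2, hone (hF 0),
    integral_finsetSum _ fun s _ => hint ((hE s).inter (hF (s + 1)))]
  have h5 : ∀ s, ∫ ω, (E s ∩ F (s + 1)).indicator (fun _ => (1 : ℝ)) ω ∂μ ≤ p * μ.real (E s) := by
    intro s
    rw [hone ((hE s).inter (hF (s + 1)))]
    have h6 : μ.real (E s ∩ F (s + 1)) = μ.real (E s) * μ.real (F (s + 1)) :=
      measureReal_triggers_and_failure_eq hg hi s M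
    rw [h6, mul_comm]
    exact mul_le_mul_of_nonneg_right (hp _) measureReal_nonneg
  calc _ ≤ p + ∑ s ∈ Finset.range T, p * μ.real (E s) :=
        add_le_add (hp 0) (Finset.sum_le_sum fun s _ => h5 s)
    _ = p + p * ∑ s ∈ Finset.range T, μ.real (E s) := by rw [Finset.mul_sum]
    _ ≤ p + p * M := by gcongr
    _ = p * (M + 1) := by ring

lemma recomputations_eq_zero (h1 : 1 / 40 ≤ ε) (hpsd : ∀ t ≤ T, (matrixAt A₀ v t).PosSemidef)
    (hn : 2 ≤ n) (G : ℕ → Vecs n) {t : ℕ} (ht : t ≤ T) :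
    (run ε A₀ v G t).recomputations = 0 := by
  induction t with
  | zero => rfl
  | succ t ih =>
    have hnot : ¬ Triggers ε (matrixAt A₀ v (t + 1)) (run ε A₀ v G t) := by
      rintro ⟨i, W, -, hW⟩
      have hR : 0 < numCopies n := Nat.ceil_pos.2 <|
        mul_pos (by norm_num) (Real.log_pos (by exact_mod_cast hn))
      have := quad_nonneg (hpsd _ ht) (W ⟨0, hR⟩)
      linarith [hW ⟨0, hR⟩]
    rw [run, update_recomputations_of_not_triggers hnot]
    exact ih (by omega)

lemma four_add_div_le_bound (hn : 2 ≤ n) (h0 : 0 < ε) (h1 : ε < 1 / 40) :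
    4 + 432 * Real.log (n / ε) / ε ≤ Real.log n * Real.log (n / ε) ^ 5 / ε ^ 2 := by
  have hn0 : (2 : ℝ) ≤ n := by exact_mod_cast hn
  have hlog2 : 0.69 ≤ Real.log 2 := by linarith [Real.log_two_gt_d9]
  have hlogn : Real.log 2 ≤ Real.log n := Real.log_le_log (by norm_num) hn0
  have hℓ : 4 ≤ Real.log (n / ε) := by
    have h2 : (2 : ℝ) ^ 6 ≤ n / ε := by
      rw [le_div_iff₀ h0]; linarith
    have h3 := Real.log_le_log (by norm_num) h2
    rw [Real.log_pow] at h3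
    push_cast at h3
    linarith
  set ℓ := Real.log (n / ε)
  have h4 : 256 * ℓ ≤ ℓ ^ 5 := by
    have h5 : (4 : ℝ) ^ 4 ≤ ℓ ^ 4 := pow_le_pow_left₀ (by norm_num) hℓ 4
    have h6 : ℓ ^ 5 = ℓ ^ 4 * ℓ := pow_succ _ _
    rw [h6]
    nlinarith
  rw [show 4 + 432 * ℓ / ε = (4 * ε + 432 * ℓ) * ε / ε ^ 2 by field_simp]
  refine div_le_div_of_nonneg_right ?_ (by positivity)
  have h7 : 0.69 * (256 * ℓ) ≤ Real.log n * ℓ ^ 5 :=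
    mul_le_mul (by linarith) h4 (by positivity) (by linarith)
  nlinarith

/-- The probability bound for measurable initial vectors, with constant `1`. -/
lemma one_sub_le_measureReal_recomputations_le (hn : 2 ≤ n) (h0 : 0 < ε)
    (hε : ε < 1) (hmax : lambdaMax A₀ ≤ 1 + ε / Real.log n)
    (hpsd : ∀ t ≤ T, (matrixAt A₀ v t).PosSemidef)
    (hg : ∀ j, Measurable (g j)) (hlaw : ∀ j, HasLaw (g j) (gaussianReal 0 1) μ)
    (hi : iIndepFun g μ) :
    1 - 1 / (n : ℝ) ≤ μ.real {ω |
      ((run ε A₀ v (initialVecs fun j => g j ω) T).recomputations : ℝ) ≤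
        Real.log n * Real.log (n / ε) ^ 5 / ε ^ 2} := by
  have := hi.isProbabilityMeasure
  have hn0 : (2 : ℝ) ≤ n := by exact_mod_cast hn
  have hlogn : 0 < Real.log n := Real.log_pos (by linarith)
  rcases le_or_gt (1 / 40) ε with h1 | h1
  · have hall : ∀ ω, ((run ε A₀ v (initialVecs fun j => g j ω) T).recomputations : ℝ) ≤
        Real.log n * Real.log (n / ε) ^ 5 / ε ^ 2 := fun ω => by
      have hℓ : 0 ≤ Real.log (n / ε) ^ 5 / ε ^ 2 :=
        div_nonneg (pow_nonneg (Real.log_nonneg (by rw [le_div_iff₀ h0]; linarith)) _)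
          (sq_nonneg ε)
      rw [recomputations_eq_zero h1 hpsd hn _ le_rfl, Nat.cast_zero, mul_div_assoc]
      exact mul_nonneg hlogn.le hℓ
    simp only [hall, Set.ofPred_true, probReal_univ]
    have : 0 ≤ 1 / (n : ℝ) := by positivity
    linarith
  set ℓ := Real.log (n / ε) with hℓ
  have hℓ0 : 0 ≤ ℓ := Real.log_nonneg (by rw [le_div_iff₀ h0]; linarith)
  set N := 216 * ℓ / ε with hN
  have hN0 : 0 ≤ N := by positivity
  set M := ⌈3 + 2 * N⌉₊ with hM
  have hM1 : 3 + 2 * N ≤ M := Nat.le_ceil _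
  have hM2 : (M : ℝ) ≤ 4 + 432 * ℓ / ε := by
    have h2 := (Nat.ceil_lt_add_one (show 0 ≤ 3 + 2 * N by linarith)).le
    have h3 : 432 * ℓ / ε = 2 * N := by rw [hN]; ring
    rw [h3]; linarith
  obtain ⟨hint, hEZ⟩ := integral_earlyFailures_le (ε := ε) (A₀ := A₀) (v := v) (T := T) hg hi
    (measureReal_failureSet_le hn h0 h1 hmax hpsd hg hlaw hi) M
  set Z : Ω → ℝ := fun ω => earlyFailures ε A₀ v T M (initialVecs fun j => g j ω) with hZ
  have hZ0 : ∀ ω, 0 ≤ Z ω := fun ω => by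
    classical
    rw [hZ]
    simp only [earlyFailures]
    exact add_nonneg (by split_ifs <;> norm_num)
      (Finset.sum_nonneg fun s _ => by split_ifs <;> norm_num)
  have hmk := mul_meas_ge_le_integral_of_nonneg (μ := μ) (ae_of_all _ hZ0) hint (M - 1 - N)
  have hbad : μ.real {ω | M - 1 - N ≤ Z ω} ≤ 1 / n := by
    have h2 : (M - 1 - N) * μ.real {ω | M - 1 - N ≤ Z ω} ≤ (M - 1 - N) * (1 / n) := by
      refine (hmk.trans hEZ).trans ?_
      have h3 : 1 / (2 * (n : ℝ)) * (M + 1) = (M + 1) / 2 * (1 / n) := by field_simp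
      rw [h3]
      exact mul_le_mul_of_nonneg_right (by linarith) (by positivity)
    exact le_of_mul_le_mul_left h2 (by linarith)
  have hcover : Set.univ ⊆ {ω | ((run ε A₀ v (initialVecs fun j => g j ω) T).recomputations : ℝ) ≤
      Real.log n * ℓ ^ 5 / ε ^ 2} ∪ {ω | M - 1 - N ≤ Z ω} := by
    intro ω _
    rcases le_or_gt (run ε A₀ v (initialVecs fun j => g j ω) T).recomputations M with hc | hc
    · left
      have h2 : ((run ε A₀ v (initialVecs fun j => g j ω) T).recomputations : ℝ) ≤ M := by
        exact_mod_cast hc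
      exact h2.trans (hM2.trans (four_add_div_le_bound hn h0 h1))
    · right
      -- At the time of the `M`-th recomputation, at least `M - 1 - N` calls have failed.
      obtain ⟨t, ht, he⟩ := exists_recomputations_eq _ hc
      have h2 := recomputations_le_failures_add hn h0 h1 hmax hpsd
        (initialVecs fun j => g j ω) ht
      have h3 := failures_le_earlyFailures (ε := ε) (A₀ := A₀) (v := v) _ ht he
      rw [he] at h2
      have h4 : M - 1 - N ≤ Z ω := by
        rw [hZ]
        simp only
        linarith
      exact h4
  have h2 := (measureReal_mono (μ := μ) hcover).trans (measureReal_union_le _ _)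
  rw [probReal_univ] at h2
  linarith

end Probability

end DynPower

theorem mainTheorem2 :
    ∃ C : ℝ, 0 < C ∧
      ∀ (n : ℕ) (ε : ℝ) (A₀ : Matrix (Fin n) (Fin n) ℝ) (T : ℕ) (v : ℕ → Fin n → ℝ),
        2 ≤ n → 0 < ε → ε < 1 →
        DynPower.lambdaMax A₀ ≤ 1 + ε / Real.log n →
        (∀ t ≤ T, (DynPower.matrixAt A₀ v t).PosSemidef) →
        ∀ (Ω : Type*) [MeasurableSpace Ω] (μ : Measure Ω) [IsProbabilityMeasure μ]
          (g : ℕ → Fin (DynPower.numCopies n) → Fin n → Ω → ℝ),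
          (∀ t r i, HasLaw (g t r i) (gaussianReal 0 1) μ) →
          iIndepFun (fun j : ℕ × Fin (DynPower.numCopies n) × Fin n => g j.1 j.2.1 j.2.2) μ →
          1 - 1 / (n : ℝ) ≤
            μ.real {ω | ((DynPower.run ε A₀ v (fun t r i => g t r i ω) T).recomputations : ℝ) ≤
              C * (Real.log n * Real.log (n / ε) ^ 5 / ε ^ 2)} := by
  refine ⟨1, one_pos, fun n ε A₀ T v hn h0 h1 hmax hpsd Ω _ μ _ g hlaw hi => ?_⟩
  simp only [one_mul]
  -- Replace the almost everywhere measurable `g` by measurable versions.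
  set g' : ℕ × Fin (DynPower.numCopies n) × Fin n → Ω → ℝ := fun j =>
    (hlaw j.1 j.2.1 j.2.2).aemeasurable.mk with hg'
  have hae : ∀ j : ℕ × Fin (DynPower.numCopies n) × Fin n, g j.1 j.2.1 j.2.2 =ᵐ[μ] g' j :=
    fun j => (hlaw j.1 j.2.1 j.2.2).aemeasurable.ae_eq_mk
  have main := DynPower.one_sub_le_measureReal_recomputations_le (g := g') hn h0 h1 hmax hpsd
    (fun j => (hlaw j.1 j.2.1 j.2.2).aemeasurable.measurable_mk)
    (fun j => (hlaw j.1 j.2.1 j.2.2).congr (hae j).symm) (hi.congr hae)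
  refine main.trans (le_of_eq (measureReal_congr ?_))
  filter_upwards [ae_all_iff.2 hae] with ω hω
  have hG : DynPower.initialVecs (fun j => g' j ω) = fun t r i => g t r i ω := by
    funext t r i
    exact (hω (t, r, i)).symm
  refine propext ?_
  change (_ ≤ _) ↔ (_ ≤ _)
  rw [hG]
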